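/- Let $G$ be a nonempty, second countable, Hausdorff, ample topological groupoid (that is, the topology of $G$ has a basis of compact open bisections: compact open sets $B$ on which the range map $r$ and the source map $s$ are homeomorphisms onto open subsets of the unit space $G^{(0)}$). Suppose that $G$ is topologically principal, i.e. $\{u\in G^{(0)} : \{\gamma : r(\gamma)=s(\gamma)=u\}=\{u\}\}$ is dense in $G^{(0)}$, and minimal, i.e. $\{r(\gamma) : s(\gamma)=u\}$ is dense in $G^{(0)}$ for every $u\in G^{(0)}$. Let $C^*_r(G)$ be the completion of $C_c(G)$ in the norm $\|f\|_r=\sup_{u\in G^{(0)}}\|\pi_u(f)\|$, where $\pi_u$ is the representation on $\ell^2(\{\gamma : s(\gamma)=u\})$ with $\pi_u(f)\delta_\gamma=\sum_{s(\eta)=r(\gamma)}f(\eta)\delta_{\eta\gamma}$, and regard $C_0(G^{(0)})$ as a subalgebra of $C^*_r(G)$ by extending functions by zero. Then $C^*_r(G)$ is purely infinite if and only if there exist a point $x\in G^{(0)}$ and a neighbourhood basis $\mathcal{D}$ at $x$ in $G^{(0)}$, consisting of compact open sets, such that every nonzero projection $q\in C_0(G^{(0)})$ with $\operatorname{supp}(q)\in\mathcal{D}$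 is infinite in $C^*_r(G)$. Here a $C^*$-algebra $A$ is purely infinite if it has no characters and, for all positive $a,b\in A$, there is a sequence $(x_k)$ in $A$ with $x_k^*bx_k\to a$ in norm if and only if $a\in\overline{AbA}$, the closed linear span of $\{xby : x,y\in A\}$; a projection $p\in A$ is infinite if there is $v\in A$ with $v^*v=p$, $vv^*\le p$ and $vv^*\neq p$. -/

import Mathlib

open Topology
open scoped ENNReal ZeroAtInfty CompactlySupported

/-- A groupoid, presented by its set `G` of morphisms; objects are identified with identity
morphisms.  `src γ` and `rng γ` are the source and range of `γ`, and `a * b` is the composite of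
`a` and `b` when `src a = rng b`.  The values of `*` on non-composable pairs are irrelevant: no law
constrains them and no definition below uses them. -/
class ArrowGroupoid (G : Type*) extends Mul G, Inv G where
  /-- The source of a morphism, as an identity morphism. -/
  src : G → G
  /-- The range of a morphism, as an identity morphism. -/
  rng : G → G
  src_src (a : G) : src (src a) = src a
  rng_src (a : G) : rng (src a) = src a
  src_rng (a : G) : src (rng a) = rng a
  rng_rng (a : G) : rng (rng a) = rng a
  src_mul (a b : G) : src a = rng b → src (a * b) = src b
  rng_mul (a b : G) : src a = rng b → rng (a * b) = rng a
  mul_assoc_of_composable (a b c : G) : src a = rng b → src b = rng c → a * b * c = a * (b * c)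
  mul_src_self (a : G) : a * src a = a
  rng_mul_self (a : G) : rng a * a = a
  src_inv (a : G) : src a⁻¹ = rng a
  rng_inv (a : G) : rng a⁻¹ = src a
  mul_inv_self (a : G) : a * a⁻¹ = rng a
  inv_mul_self (a : G) : a⁻¹ * a = src a

/-- A topological groupoid: composition is continuous on the set of composable pairs and inversion
(which is an involution) is continuous, hence a homeomorphism. -/
class IsTopologicalGroupoid (G : Type*) [TopologicalSpace G] [ArrowGroupoid G] : Prop where
  continuousOn_mul : ContinuousOn (fun p : G × G => p.1 * p.2)
    {p : G × G | ArrowGroupoid.src p.1 = ArrowGroupoid.rng p.2}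
  continuous_inv : Continuous (fun a : G => a⁻¹)

noncomputable section

namespace ArrowGroupoid

/-- The unit space `G⁽⁰⁾` (with the subspace topology, when `G` carries a topology). -/
abbrev UnitSpace (G : Type*) [ArrowGroupoid G] : Type _ := {u : G // src u = u}

variable {G : Type*} [ArrowGroupoid G]

/-- The source map `s : G → G⁽⁰⁾`. -/
def s (a : G) : UnitSpace G := ⟨src a, src_src a⟩

/-- The range map `r : G → G⁽⁰⁾`. -/
def r (a : G) : UnitSpace G := ⟨rng a, src_rng a⟩

section Topology

variable [TopologicalSpace G]

/-- An open bisection: an open set on which `r` and `s` are homeomorphisms onto open subsets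
of the unit space. -/
structure IsOpenBisection (B : Set G) : Prop where
  isOpen : IsOpen B
  isOpenEmbedding_s : IsOpenEmbedding (B.domRestrict s)
  isOpenEmbedding_r : IsOpenEmbedding (B.domRestrict r)

variable (G)

/-- The groupoid has a basis of compact open bisections. -/
def IsAmple : Prop :=
  TopologicalSpace.IsTopologicalBasis {B : Set G | IsCompact B ∧ IsOpenBisection B}

/-- The units with trivial isotropy, `u G u = {u}`, are dense in the unit space. -/
def IsTopologicallyPrincipal : Prop :=
  Dense {u : UnitSpace G | {a : G | r a = u ∧ s a = u} = {(u : G)}}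

/-- Every orbit `G · u = {r γ : s γ = u}` is dense in the unit space. -/
def IsMinimal : Prop :=
  ∀ u : UnitSpace G, Dense {v : UnitSpace G | ∃ a : G, s a = u ∧ r a = v}

end Topology

/-- The set `G u` of morphisms with source `u`. -/
abbrev SourceFibre (u : UnitSpace G) : Type _ := {a : G // s a = u}

/-- The Hilbert space `ℓ²(G u)`. -/
abbrev FibreSpace (u : UnitSpace G) : Type _ := lp (fun _ : SourceFibre u => ℂ) 2

open Classical in
/-- The point mass `δ_γ ∈ ℓ²(G u)`. -/
def pointMass {u : UnitSpace G} (γ : SourceFibre u) : FibreSpace u := lp.single 2 γ (1 : ℂ)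

/-- The composite `η γ ∈ G u`, for `γ ∈ G u` and `s η = r γ`. -/
def fibreMul {u : UnitSpace G} (γ : SourceFibre u) (η : {η : G // s η = r γ.1}) : SourceFibre u :=
  ⟨η.1 * γ.1, (Subtype.ext (src_mul η.1 γ.1 (congrArg Subtype.val η.2))).trans γ.2⟩

/-- The C⋆-algebra `∏_u B(ℓ²(G u))` of bounded families of operators, with the norm
`‖(T u)_u‖ = sup_u ‖T u‖` and pointwise operations. -/
def RegularProduct (G : Type*) [ArrowGroupoid G] : Type _ :=
  lp (fun u : UnitSpace G => FibreSpace u →L[ℂ] FibreSpace u) ∞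

instance instRegularProduct (G : Type*) [ArrowGroupoid G] : NonUnitalCStarAlgebra (RegularProduct G) :=
  inferInstanceAs (NonUnitalCStarAlgebra
    (lp (fun u : UnitSpace G => FibreSpace u →L[ℂ] FibreSpace u) ∞))

/-- The component `T u` of a family `T ∈ ∏_u B(ℓ²(G u))`. -/
def RegularProduct.component (T : RegularProduct G) (u : UnitSpace G) :
    FibreSpace u →L[ℂ] FibreSpace u :=
  (show lp (fun u : UnitSpace G => FibreSpace u →L[ℂ] FibreSpace u) ∞ from T) u

/-- `T` is the family `(π_u(f))_u` of regular representations at `f`, that is,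
`π_u(f) δ_γ = ∑_{s η = r γ} f(η) δ_{ηγ}` for all `u` and all `γ ∈ G u`. -/
def IsRegularRep (f : G → ℂ) (T : RegularProduct G) : Prop :=
  ∀ (u : UnitSpace G) (γ : SourceFibre u),
    HasSum (fun η : {η : G // s η = r γ.1} => f η.1 • pointMass (fibreMul γ η))
      (T.component u (pointMass γ))

/-- The reduced C⋆-algebra `C*_r(G)`: the closed ⋆-subalgebra of `∏_u B(ℓ²(G u))` generated by the
families `(π_u(f))_u`, `f ∈ C_c(G)`.  For a locally compact Hausdorff étale groupoid these families
form a ⋆-algebra, the image of the convolution algebra `C_c(G)`, on which the norm is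
`‖f‖_r = sup_u ‖π_u(f)‖`; so the closure is the completion of `C_c(G)` in the reduced norm. -/
def reducedCStar (G : Type*) [ArrowGroupoid G] [TopologicalSpace G] :
    NonUnitalStarSubalgebra ℂ (RegularProduct G) :=
  (NonUnitalStarAlgebra.adjoin ℂ
    {T : RegularProduct G | ∃ f : C_c(G, ℂ), IsRegularRep f T}).topologicalClosure

instance instReducedCStar (G : Type*) [ArrowGroupoid G] [TopologicalSpace G] :
    NonUnitalCStarAlgebra (reducedCStar G) :=
  NonUnitalStarSubalgebra.nonUnitalCStarAlgebra (reducedCStar G)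
    (h_closed := NonUnitalStarSubalgebra.isClosed_topologicalClosure _)

/-- `a ∈ C*_r(G)` is the image of `h ∈ C₀(G⁽⁰⁾)` under the canonical embedding
`C₀(G⁽⁰⁾) → C*_r(G)`.  For `h ∈ C_c(G⁽⁰⁾)`, extended by zero to `G`, the formula for `π_u(h)` reads
`π_u(h) δ_γ = h(r γ) δ_γ`, and by continuity the same formula describes the image of every
`h ∈ C₀(G⁽⁰⁾)`. -/
def IsUnitSpaceImage [TopologicalSpace G] (h : C₀(UnitSpace G, ℂ)) (a : reducedCStar G) : Prop :=
  ∀ (u : UnitSpace G) (γ : SourceFibre u),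
    (a : RegularProduct G).component u (pointMass γ) = h (r γ.1) • pointMass γ

end ArrowGroupoid

namespace CStarNotions

variable {A : Type*} [NonUnitalCStarAlgebra A]

/-- Positive elements of a C⋆-algebra. -/
def IsPos (a : A) : Prop := ∃ b : A, a = star b * b

/-- Cuntz comparison `a ≾ b` of elements of `A`. -/
def CuntzBelow (a b : A) : Prop :=
  ∃ x : ℕ → A, Filter.Tendsto (fun k => star (x k) * b * x k) Filter.atTop (𝓝 a)

/-- The closed two-sided ideal `A b A` (closed linear span of the products `x b y`). -/
def idealClosure (b : A) : Set A :=
  closure (Submodule.span ℂ {c : A | ∃ x y : A, c = x * b * y} : Set A)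

variable (A) in
/-- Pure infiniteness: `A` has no characters, and for positive `a`, `b` one has `a ≾ b` exactly
when `a` lies in the closed two-sided ideal generated by `b`. -/
def IsPurelyInfinite : Prop :=
  IsEmpty (WeakDual.characterSpace ℂ A) ∧
    ∀ a b : A, IsPos a → IsPos b → (CuntzBelow a b ↔ a ∈ idealClosure b)

/-- An infinite projection: a projection `p` for which there is `v` with `v⋆v = p` and `vv⋆` a
proper subprojection of `p`. -/
def IsInfiniteProjection (p : A) : Prop :=
  IsStarProjection p ∧
    ∃ v : A, star v * v = p ∧ p * (v * star v) = v * star v ∧ v * star v ≠ p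

end CStarNotions

end

/-! An element of `reducedCStar G` is studied through its matrix on each ℓ²(G u). For the elements
used, the entry at (α, γ) is the value of one function on G at αγ⁻¹ (`HasMatrix`). Indicators of
compact open bisections multiply like the bisections and span a dense ⋆-subalgebra.

Three facts carry the theorem. Topological principality: every nonzero positive b is conjugated by
some x onto a projection 1_V, with V a nonempty compact open set of units
(`exists_conj_eq_unitProj`). After approximating b by an element of the span, cutting down near a
unit with trivial isotropy removes everything off the unit space, and what remains is a positive
scalar up to a small error. Minimality: each such 1_V is full in the strong sense that every
positive element is a limit of finite sums of conjugates x⋆ 1_V x (`mem_closure_conjCone_unitProj`).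
Infinite projections: if v⋆v = p and vv⋆ < p, the defect e = p - vv⋆ is nonzero, hence full by the
two facts above. Copies of e shifted by powers of v are orthogonal inside p, so any finite sum of
conjugates of e is one conjugate of p. Thus every positive element is Cuntz below p.

Sufficiency: from b ≠ 0 pass to 1_V. Minimality supplies a bisection from a small neighbourhood U ∈
D of x into V, so 1_U is a conjugate of b. As 1_U is infinite, every positive a is below b.
Necessity: pure infiniteness excludes isolated units, by a rank-one argument or by a character when
G is a single point. So a nonempty U properly contains a nonempty compact open V. Fullness gives 1_U
≾ 1_V, which can be made an exact equality 1_U = z⋆ 1_V z, and this makes 1_U infinite. -/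

noncomputable section

/-! ### Cuntz comparison, sums of conjugates and infinite projections in a C⋆-algebra. -/

namespace CStarNotions

variable {A : Type*} [NonUnitalCStarAlgebra A]

lemma IsPos.isSelfAdjoint {a : A} (ha : IsPos a) : IsSelfAdjoint a := by
  obtain ⟨b, rfl⟩ := ha
  exact IsSelfAdjoint.star_mul_self b

lemma IsStarProjection.isPos {p : A} (hp : IsStarProjection p) : IsPos p :=
  ⟨p, by rw [hp.isSelfAdjoint.star_eq, hp.isIdempotentElem.eq]⟩

/-- A self-adjoint element of the corner `pAp` close to the projection `p` can be conjugated
to `p`. -/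
lemma exists_conj_eq_of_norm_sub_le {p y : A} (hp : IsStarProjection p) (hy : IsSelfAdjoint y)
    (hpy : p * y = y) (hyp : y * p = y) (hn : ‖y - p‖ ≤ 1 / 2) :
    ∃ x : A, star x * y * x = p := by
  set w := y - p with hw
  have hpp : p * p = p := hp.isIdempotentElem.eq
  have hws : IsSelfAdjoint w := hy.sub hp.isSelfAdjoint
  -- The element sought is y^(-1/2) in the corner, with y = p + w. Subtracting 1 gives h 0 = 0, as
  -- the non-unital functional calculus requires.
  set h : ℝ → ℝ := fun t => (Real.sqrt (1 + t))⁻¹ - 1 with hh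
  have hspec : ∀ t ∈ quasispectrum ℝ w, -(1 / 2) ≤ t := by
    intro t ht
    have := (NonUnitalIsometricContinuousFunctionalCalculus.norm_quasispectrum_le w ht hws).trans hn
    rw [Real.norm_eq_abs] at this
    exact (abs_le.1 this).1
  have hc : ContinuousOn h (quasispectrum ℝ w) := by
    refine ContinuousOn.sub (ContinuousOn.inv₀ (by fun_prop) ?_) continuousOn_const
    intro t ht
    have := hspec t ht
    exact (Real.sqrt_pos.2 (by linarith)).ne'
  have h0 : h 0 = 0 := by simp [hh]
  set g := cfcₙ h w with hg
  have hgs : star g = g := (cfcₙ_predicate h w : IsSelfAdjoint g).star_eq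
  have hcomm : Commute p g := by
    have : Commute w p := by
      simp only [Commute, SemiconjBy, hw, sub_mul, mul_sub, hpy, hyp]
    exact (IsSelfAdjoint.commute_cfcₙ hws this h).symm
  have hwg : w * g = cfcₙ (fun t => t * h t) w := by
    rw [cfcₙ_mul (fun t => t) h w, cfcₙ_id' ℝ w]
  -- This is (1 + w)(1 + g)² = 1 expanded, with the unit cancelled since A need not have one.
  have key : w + g + g + g * g + w * g + w * g + w * g * g = 0 := by
    have e1 : g * g = cfcₙ (fun t => h t * h t) w := by rw [cfcₙ_mul h h w]
    have e2 : w * g * g = cfcₙ (fun t => t * h t * h t) w := by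
      rw [hwg, ← cfcₙ_mul (fun t => t * h t) h w]
    have e3 : w = cfcₙ (fun t : ℝ => t) w := (cfcₙ_id' ℝ w).symm
    rw [e2, e1, hwg]
    nth_rw 1 [e3]
    rw [hg, ← cfcₙ_add (fun t : ℝ => t) h w, ← cfcₙ_add _ h w,
      ← cfcₙ_add _ (fun t => h t * h t) w, ← cfcₙ_add _ (fun t => t * h t) w,
      ← cfcₙ_add _ (fun t => t * h t) w, ← cfcₙ_add _ (fun t => t * h t * h t) w]
    rw [← cfcₙ_zero ℝ w]
    refine cfcₙ_congr fun t ht => ?_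
    have ht' := hspec t ht
    have hs : 0 < Real.sqrt (1 + t) := Real.sqrt_pos.2 (by linarith)
    have hsq : Real.sqrt (1 + t) * Real.sqrt (1 + t) = 1 + t := Real.mul_self_sqrt (by linarith)
    have : (1 + t) * ((1 + h t) * (1 + h t)) = 1 := by
      simp only [hh, add_sub_cancel]
      rw [← mul_inv, hsq]
      exact mul_inv_cancel₀ (by linarith)
    simp only [Pi.zero_apply]
    linarith
  refine ⟨p + g * p, ?_⟩
  have hy' : y = p + w := by simp [hw]
  have hgp : g * p = p * g := hcomm.symm
  have hwp : w * p = w := by simp [hw, sub_mul, hyp, hpp]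
  have hpw : p * w = w := by simp [hw, mul_sub, hpy, hpp]
  have hwgc : w * g = g * w := (IsSelfAdjoint.commute_cfcₙ hws (Commute.refl w) h).eq.symm
  rw [star_add, star_mul, hgs, hp.isSelfAdjoint.star_eq]
  have : (p + p * g) * y * (p + g * p) =
      p * (w + g + g + g * g + w * g + w * g + w * g * g) * p + p := by
    have a1 : (p + p * g) * y = p + w + p * g + w * g := by
      rw [hy', add_mul, mul_add, mul_add, hpp, hpw, ← hgp, mul_assoc g p p, hpp, mul_assoc g p w, hpw,
        hwgc]
      abel
    rw [a1]
    simp only [mul_add, add_mul, hgp, hpp, hwp, hpw, ← mul_assoc]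
    have b1 : w * p = w := hwp
    have b2 : p * g * p = p * g := by rw [mul_assoc, hgp, ← mul_assoc, hpp]
    have b3 : w * g * p = w * g := by rw [mul_assoc, hgp, ← mul_assoc, hwp]
    have b6 : p * g * g * p = p * g * g := by
      rw [mul_assoc, hgp, ← mul_assoc, b2]
    have b7 : w * g * g * p = w * g * g := by rw [mul_assoc, hgp, ← mul_assoc, b3]
    simp only [b2, b3, b6, b7]
    abel
  rw [this, key]
  simp

/-- If a projection is Cuntz below a self-adjoint element, it is exactly a conjugate of it. -/
lemma CuntzBelow.exists_eq {p b : A} (hp : IsStarProjection p) (hb : IsSelfAdjoint b)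
    (h : CuntzBelow p b) : ∃ x : A, star x * b * x = p := by
  obtain ⟨x, hx⟩ := h
  have hpp : p * p = p := hp.isIdempotentElem.eq
  have hps : star p = p := hp.isSelfAdjoint.star_eq
  -- Compressing by p moves the approximants into the corner pAp without changing the limit; one
  -- approximant within 1/2 of p is enough.
  have h1 : Filter.Tendsto (fun k => p * (star (x k) * b * x k) * p) Filter.atTop (𝓝 p) := by
    have : Filter.Tendsto (fun k => p * (star (x k) * b * x k) * p) Filter.atTop
      (𝓝 (p * p * p)) := (hx.const_mul p).mul_const p
    rwa [hpp, hpp] at this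
  obtain ⟨k, hk⟩ := ((Metric.tendsto_nhds.1 h1) (1 / 2) (by norm_num)).exists
  have hs : IsSelfAdjoint (p * (star (x k) * b * x k) * p) := by
    rw [IsSelfAdjoint]
    simp only [star_mul, hps, hb.star_eq, star_star, mul_assoc]
  obtain ⟨z, hz⟩ := exists_conj_eq_of_norm_sub_le (y := p * (star (x k) * b * x k) * p) hp hs
    (by simp only [← mul_assoc, hpp]) (by simp only [mul_assoc, hpp])
    (by rw [← dist_eq_norm]; exact hk.le)
  refine ⟨x k * p * z, ?_⟩
  refine Eq.trans ?_ hz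
  simp only [star_mul, hps, mul_assoc]

/-- The finite sums of conjugates `x⋆ b x`. -/
def conjCone (b : A) : AddSubmonoid A := AddSubmonoid.closure {c | ∃ x : A, c = star x * b * x}

lemma conj_mem_conjCone {b c : A} (hc : c ∈ conjCone b) (x : A) :
    star x * c * x ∈ conjCone b := by
  induction hc using AddSubmonoid.closure_induction with
  | mem c hc =>
    obtain ⟨z, rfl⟩ := hc
    exact AddSubmonoid.subset_closure ⟨z * x, by simp only [star_mul, mul_assoc]⟩
  | zero => simp
  | add c d _ _ hc hd =>
    rw [mul_add, add_mul]
    exact add_mem hc hd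

lemma conjCone_le {b c : A} (hc : c ∈ conjCone b) : conjCone c ≤ conjCone b := by
  refine (AddSubmonoid.closure_le).2 ?_
  rintro _ ⟨x, rfl⟩
  exact conj_mem_conjCone hc x

/-- Continuity of b ↦ b⋆b reduces membership in the closure to squares of elements of a dense set.
-/
lemma IsPos.mem_closure_conjCone {e a : A} {S : Set A} (hS : Dense S)
    (he : ∀ c ∈ S, star c * c ∈ conjCone e) (ha : IsPos a) :
    a ∈ closure (conjCone e : Set A) := by
  obtain ⟨b, rfl⟩ := ha
  have hc : Continuous fun b : A => star b * b := continuous_star.mul continuous_id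
  exact map_mem_closure (f := fun b : A => star b * b) hc (hS b) he

lemma conjCone_subset_idealClosure (b : A) : (conjCone b : Set A) ⊆ idealClosure b := by
  refine Set.Subset.trans ?_ subset_closure
  intro c hc
  induction hc using AddSubmonoid.closure_induction with
  | mem c hc =>
    obtain ⟨z, rfl⟩ := hc
    exact Submodule.subset_span ⟨_, _, rfl⟩
  | zero => exact zero_mem _
  | add c d _ _ hc hd => exact add_mem hc hd

lemma CuntzBelow.mem_idealClosure {a b : A} (h : CuntzBelow a b) : a ∈ idealClosure b := by
  obtain ⟨x, hx⟩ := h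
  exact mem_closure_of_tendsto hx (.of_forall fun k => Submodule.subset_span ⟨_, _, rfl⟩)

lemma eq_zero_of_mem_idealClosure_zero {a : A} (h : a ∈ idealClosure (0 : A)) : a = 0 := by
  have : {c : A | ∃ x y : A, c = x * 0 * y} = {0} := by
    ext c; simp
  rw [idealClosure, this, Submodule.span_zero_singleton] at h
  simpa using h

/-- Identities for `v` with `v⋆ v = p` and `v v⋆ ≤ p`. -/
lemma mul_eq_of_star_mul_eq {p v : A} (hp : IsStarProjection p) (h1 : star v * v = p)
    (h2 : p * (v * star v) = v * star v) :
    p * v = v ∧ v * p = v ∧ star v * p = star v ∧ p * star v = star v := by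
  have hpp : p * p = p := hp.isIdempotentElem.eq
  have hps : star p = p := hp.isSelfAdjoint.star_eq
  have hvp : v * p = v := by
    have : star (v * p - v) * (v * p - v) = 0 := by
      simp only [star_sub, star_mul, hps, sub_mul, mul_sub]
      have e1 : p * star v * (v * p) = p := by
        rw [mul_assoc, ← mul_assoc (star v), h1, hpp, hpp]
      have e2 : star v * (v * p) = p := by rw [← mul_assoc, h1, hpp]
      have e3 : p * star v * v = p := by rw [mul_assoc, h1, hpp]
      rw [e1, e2, e3, h1]; simp
    exact sub_eq_zero.1 ((CStarRing.star_mul_self_eq_zero_iff _).1 this)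
  have hvv : v * star v * v = v := by rw [mul_assoc, h1, hvp]
  have hpv : p * v = v := by
    calc p * v = p * (v * star v) * v := by rw [mul_assoc, hvv]
      _ = v := by rw [h2, hvv]
  have hsp : star v * p = star v := by
    have := congrArg star hpv
    rwa [star_mul, hps] at this
  have hpsv := congrArg star hvp
  rw [star_mul, hps] at hpsv
  exact ⟨hpv, hvp, hsp, hpsv⟩

lemma isStarProjection_defect {p v : A} (hp : IsStarProjection p) (h1 : star v * v = p)
    (h2 : p * (v * star v) = v * star v) : IsStarProjection (p - v * star v) := by
  have hpp : p * p = p := hp.isIdempotentElem.eq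
  obtain ⟨hpv, hvp, hsp, hpsv⟩ := mul_eq_of_star_mul_eq hp h1 h2
  refine ⟨?_, by simp [IsSelfAdjoint, hp.isSelfAdjoint.star_eq]⟩
  have e1 : v * star v * p = v * star v := by rw [mul_assoc, hsp]
  have e2 : v * star v * (v * star v) = v * star v := by
    rw [mul_assoc, ← mul_assoc (star v), h1, hpsv]
  rw [IsIdempotentElem, sub_mul, mul_sub, mul_sub, hpp, h2, e1, e2, sub_self, sub_zero]

/-- If `p` is the initial projection of `v`, with `v v⋆ ≤ p`, then every finite sum of conjugates
of the defect `p - v v⋆` is a single conjugate of `p`. -/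
lemma exists_conj_eq_of_mem_conjCone_defect {p v : A} (hp : IsStarProjection p)
    (h1 : star v * v = p) (h2 : p * (v * star v) = v * star v) {c : A}
    (hc : c ∈ conjCone (p - v * star v)) : ∃ x : A, star x * p * x = c := by
  have hpp : p * p = p := hp.isIdempotentElem.eq
  have hps : star p = p := hp.isSelfAdjoint.star_eq
  obtain ⟨hpv, hvp, hsp, hpsv⟩ := mul_eq_of_star_mul_eq hp h1 h2
  have hee : (p - v * star v) * (p - v * star v) = p - v * star v :=
    (isStarProjection_defect hp h1 h2).isIdempotentElem.eq
  set e := p - v * star v with he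
  have hes : star e = e := by simp [he, hps]
  have hve : star v * e = 0 := by
    rw [he, mul_sub, hsp, ← mul_assoc, h1, hpsv, sub_self]
  have hev : e * v = 0 := by
    have := congrArg star hve
    rwa [star_mul, star_star, hes, star_zero] at this
  have hpe : p * e = e := by rw [he, mul_sub, hpp, h2]
  -- The extra condition px = x lets the induction run: it makes v isometric on y, and since ev = 0
  -- the new summand ez is orthogonal to vy, so the squares add.
  have main : ∃ x : A, p * x = x ∧ star x * x = c := by
    induction hc using AddSubmonoid.closure_induction_left with
    | zero => exact ⟨0, by simp, by simp⟩
    | add_left c hc d _ ih =>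
      obtain ⟨z, rfl⟩ := hc
      obtain ⟨y, hy, rfl⟩ := ih
      refine ⟨e * z + v * y, by rw [mul_add, ← mul_assoc, hpe, ← mul_assoc, hpv], ?_⟩
      have f1 : star z * e * (e * z) = star z * e * z := by
        rw [mul_assoc, ← mul_assoc e, hee, mul_assoc]
      have f2 : star z * e * (v * y) = 0 := by
        rw [mul_assoc, ← mul_assoc e, hev, zero_mul, mul_zero]
      have f3 : star y * star v * (e * z) = 0 := by
        rw [mul_assoc, ← mul_assoc (star v), hve, zero_mul, mul_zero]
      have f4 : star y * star v * (v * y) = star y * y := by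
        rw [mul_assoc, ← mul_assoc (star v), h1, hy]
      rw [star_add, star_mul, star_mul, hes, add_mul, mul_add, mul_add, f1, f2, f3, f4, add_zero,
        zero_add]
  obtain ⟨x, hx, hxx⟩ := main
  exact ⟨x, by rw [mul_assoc, hx, hxx]⟩

lemma cuntzBelow_of_mem_closure_conjCone_defect {p v a : A} (hp : IsStarProjection p)
    (h1 : star v * v = p) (h2 : p * (v * star v) = v * star v)
    (ha : a ∈ closure (conjCone (p - v * star v) : Set A)) : CuntzBelow a p := by
  obtain ⟨c, hc, hlim⟩ := mem_closure_iff_seq_limit.1 ha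
  choose x hx using fun k => exists_conj_eq_of_mem_conjCone_defect hp h1 h2 (hc k)
  exact ⟨x, by simpa only [hx] using hlim⟩

lemma CuntzBelow.conj {a b : A} (h : CuntzBelow a b) {c x : A} (hx : star x * c * x = b) :
    CuntzBelow a c := by
  obtain ⟨y, hy⟩ := h
  refine ⟨fun k => x * y k, hy.congr fun k => ?_⟩
  rw [← hx]
  simp only [star_mul, mul_assoc]

/-- The element v = ez satisfies v⋆v = p with range under e. Were vv⋆ equal to p, then ep = p, while
e ≤ p says ep = e. -/
lemma isInfiniteProjection_of_conj {p e z : A} (hp : IsStarProjection p) (he : IsStarProjection e)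
    (hpe : p * e = e) (hne : e ≠ p) (hz : star z * e * z = p) : IsInfiniteProjection p := by
  have hee : e * e = e := he.isIdempotentElem.eq
  have hes : star e = e := he.isSelfAdjoint.star_eq
  refine ⟨hp, e * z, ?_, ?_, ?_⟩
  · rw [star_mul, hes, mul_assoc, ← mul_assoc e, hee, ← mul_assoc, hz]
  · rw [← mul_assoc, ← mul_assoc, hpe]
  · intro h
    have h1 : e * p = p := by rw [← h, ← mul_assoc, ← mul_assoc, hee]
    have h2 := congrArg star hpe
    rw [star_mul, hes, hp.isSelfAdjoint.star_eq] at h2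
    exact hne (h2.symm.trans h1)

/-- A character takes values in a commutative algebra, so it agrees on v⋆v and vv⋆ and kills the
defect. -/
lemma character_eq_zero_of_mem_closure_conjCone_defect {p v a : A} (h1 : star v * v = p)
    (ha : a ∈ closure (conjCone (p - v * star v) : Set A)) (φ : WeakDual.characterSpace ℂ A) :
    φ a = 0 := by
  have he : φ (p - v * star v) = 0 := by
    rw [← h1, map_sub, map_mul, map_mul]; ring
  have hcl : IsClosed {a : A | φ a = 0} := isClosed_eq (map_continuous φ) continuous_const
  refine hcl.closure_subset_iff.2 ?_ ha
  intro c hc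
  induction hc using AddSubmonoid.closure_induction with
  | mem c hc =>
    obtain ⟨z, rfl⟩ := hc
    simp [he]
  | zero => simp
  | add c d _ _ hc hd =>
    simp only [Set.mem_ofPred_eq] at hc hd ⊢
    rw [map_add, hc, hd, add_zero]

end CStarNotions

/-! ### Compact open sets and the topology of ample groupoids. -/

/-- Induction on compact open sets: a property that holds locally and is stable under disjoint
unions holds for all compact open sets. -/
lemma compactOpen_induction {X : Type*} [TopologicalSpace X] [T2Space X] (P : Set X → Prop)
    (empty : P ∅)
    (union : ∀ K L, IsCompact K → IsOpen K → IsCompact L → IsOpen L → Disjoint K L →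
      P K → P L → P (K ∪ L))
    {K : Set X} (hK : IsCompact K) (hKo : IsOpen K)
    (loc : ∀ x ∈ K, ∃ U, IsCompact U ∧ IsOpen U ∧ x ∈ U ∧
      ∀ L ⊆ U, L ⊆ K → IsCompact L → IsOpen L → P L) : P K := by
  choose! U hUc hUo hxU hU using loc
  obtain ⟨t, htK, hcov⟩ := hK.elim_nhds_subcover U fun x hx => (hUo x hx).mem_nhds (hxU x hx)
  -- Generalising over L makes the induction work: L ∩ U x is handled locally, and L \ U x is still
  -- compact open but covered by one set fewer.
  have key : ∀ t : Finset X, (∀ x ∈ t, x ∈ K) → ∀ L ⊆ K, IsCompact L → IsOpen L →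
      L ⊆ ⋃ x ∈ t, U x → P L := by
    classical
    intro t
    induction t using Finset.induction_on with
    | empty =>
      intro _ L _ _ _ hL
      have : L = ∅ := by simpa using hL
      rw [this]; exact empty
    | insert x t hx ih =>
      intro ht L hLK hL hLo hLt
      have hxK := ht x (Finset.mem_insert_self x t)
      have h1c : IsCompact (L ∩ U x) := hL.inter (hUc x hxK)
      have h1o : IsOpen (L ∩ U x) := hLo.inter (hUo x hxK)
      have h2c : IsCompact (L \ U x) := hL.diff (hUo x hxK)
      have h2o : IsOpen (L \ U x) := hLo.sdiff (hUc x hxK).isClosed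
      rw [← Set.inter_union_sdiff L (U x)]
      refine union _ _ h1c h1o h2c h2o ?_ ?_ ?_
      · exact Set.disjoint_sdiff_right.mono_left Set.inter_subset_right
      · exact hU x hxK _ Set.inter_subset_right (Set.inter_subset_left.trans hLK) h1c h1o
      · refine ih (fun y hy => ht y (Finset.mem_insert_of_mem hy)) _
          (Set.sdiff_subset.trans hLK) h2c h2o ?_
        rintro y ⟨hy, hyx⟩
        have := hLt hy
        simp only [Set.mem_iUnion, Finset.mem_insert, exists_prop] at this ⊢
        obtain ⟨z, rfl | hz, hyz⟩ := this
        · exact absurd hyz hyx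
        · exact ⟨z, hz, hyz⟩
  exact key t htK K subset_rfl hK hKo hcov

namespace ArrowGroupoid

variable {G : Type*} [ArrowGroupoid G]

lemma s_eq_r_iff {a b : G} : s a = r b ↔ src a = rng b := Subtype.ext_iff

lemma rng_unit (u : UnitSpace G) : rng (u : G) = u := by
  conv_lhs => rw [← u.2]
  rw [rng_src, u.2]

@[simp] lemma s_unit (u : UnitSpace G) : s (u : G) = u := Subtype.ext u.2
@[simp] lemma r_unit (u : UnitSpace G) : r (u : G) = u := Subtype.ext (rng_unit u)
@[simp] lemma s_inv (a : G) : s a⁻¹ = r a := Subtype.ext (src_inv a)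
@[simp] lemma r_inv (a : G) : r a⁻¹ = s a := Subtype.ext (rng_inv a)

lemma s_mul {a b : G} (h : s a = r b) : s (a * b) = s b :=
  Subtype.ext (src_mul a b (s_eq_r_iff.1 h))
lemma r_mul {a b : G} (h : s a = r b) : r (a * b) = r a :=
  Subtype.ext (rng_mul a b (s_eq_r_iff.1 h))
lemma mul_assoc' {a b c : G} (h : s a = r b) (h' : s b = r c) : a * b * c = a * (b * c) :=
  mul_assoc_of_composable a b c (s_eq_r_iff.1 h) (s_eq_r_iff.1 h')
lemma mul_unit {a : G} {u : UnitSpace G} (h : s a = u) : a * (u : G) = a := by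
  rw [← h]; exact mul_src_self a
lemma unit_mul {a : G} {u : UnitSpace G} (h : r a = u) : (u : G) * a = a := by
  rw [← h]; exact rng_mul_self a
lemma mul_inv_eq (a : G) : a * a⁻¹ = (r a : G) := mul_inv_self a
lemma inv_mul_eq (a : G) : a⁻¹ * a = (s a : G) := inv_mul_self a

lemma mul_inv_cancel_right' {a b : G} (h : s a = r b) : a * b * b⁻¹ = a := by
  rw [mul_assoc' h (by simp), mul_inv_eq, mul_unit h]
lemma inv_mul_cancel_right' {a b : G} (h : s a = s b) : a * b⁻¹ * b = a := by
  rw [mul_assoc' (by simpa using h) (by simp), inv_mul_eq, mul_unit h]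
lemma inv_mul_cancel_left' {a b : G} (h : s a = r b) : a⁻¹ * (a * b) = b := by
  rw [← mul_assoc' (by simp) h, inv_mul_eq, unit_mul h.symm]
lemma mul_inv_cancel_left' {a b : G} (h : r a = r b) : a * (a⁻¹ * b) = b := by
  rw [← mul_assoc' (by simp) (by simpa using h), mul_inv_eq, unit_mul h.symm]

lemma inv_eq_of_mul_eq_unit {a b : G} (h : s a = r b) (h' : a * b = (r a : G)) : a⁻¹ = b := by
  have := inv_mul_cancel_left' h
  rw [h', mul_unit (by simp)] at this
  exact this

@[simp] lemma inv_inv' (a : G) : a⁻¹⁻¹ = a :=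
  inv_eq_of_mul_eq_unit (by simp) (by rw [inv_mul_eq, r_inv])

lemma inv_injective' {a b : G} (h : a⁻¹ = b⁻¹) : a = b := by
  rw [← inv_inv' a, h, inv_inv']

lemma mul_inv_rev' {a b : G} (h : s a = r b) : (a * b)⁻¹ = b⁻¹ * a⁻¹ := by
  have h2 : s b⁻¹ = r a⁻¹ := by simpa using h.symm
  refine inv_eq_of_mul_eq_unit (by rw [s_mul h, r_mul h2, r_inv]) ?_
  rw [← mul_assoc' (by rw [s_mul h, r_inv]) h2, mul_inv_cancel_right' h, mul_inv_eq, r_mul h]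

@[simp] lemma inv_unit (u : UnitSpace G) : (u : G)⁻¹ = u :=
  inv_eq_of_mul_eq_unit (by simp) (by rw [mul_unit (by simp), r_unit])

/-- This is why functions supported on units have diagonal matrices, with entry at γ governed by r
γ. -/
lemma mul_inv_eq_unit_iff {a b : G} (h : s a = s b) {u : UnitSpace G} :
    a * b⁻¹ = u ↔ a = b ∧ r b = u := by
  constructor
  · intro h'
    have h1 := inv_mul_cancel_right' h
    have h2 : r (a * b⁻¹) = u := by rw [h', r_unit]
    have h3 : s (a * b⁻¹) = u := by rw [h', s_unit]
    have h4 : s a = r b⁻¹ := by simpa using h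
    rw [s_mul h4, s_inv] at h3
    rw [h', unit_mul h3] at h1
    exact ⟨h1.symm, h3⟩
  · rintro ⟨rfl, rfl⟩
    exact mul_inv_eq a

/-- The product of two sets of morphisms. -/
def setMul (B C : Set G) : Set G := {g | ∃ b ∈ B, ∃ c ∈ C, s b = r c ∧ b * c = g}

/-- The set of inverses. -/
def setInv (B : Set G) : Set G := {g | g⁻¹ ∈ B}

/-- A set of units, as a set of morphisms. -/
def unitSet (V : Set (UnitSpace G)) : Set G := (↑) '' V

@[simp] lemma coe_mem_unitSet {V : Set (UnitSpace G)} {u : UnitSpace G} :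
    (u : G) ∈ unitSet V ↔ u ∈ V := Subtype.val_injective.mem_set_image

section Topology

variable [TopologicalSpace G]

lemma IsAmple.isOpenMap_s (h : IsAmple G) : IsOpenMap (s : G → UnitSpace G) := by
  refine h.isOpenMap_iff.2 ?_
  rintro B ⟨-, hB⟩
  have := hB.isOpenEmbedding_s.isOpen_range
  rwa [Set.range_domRestrict] at this

lemma IsAmple.isOpenMap_r (h : IsAmple G) : IsOpenMap (r : G → UnitSpace G) := by
  refine h.isOpenMap_iff.2 ?_
  rintro B ⟨-, hB⟩
  have := hB.isOpenEmbedding_r.isOpen_range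
  rwa [Set.range_domRestrict] at this

lemma IsOpenBisection.injOn_s {B : Set G} (h : IsOpenBisection B) : Set.InjOn s B :=
  Set.injOn_iff_injective.2 h.isOpenEmbedding_s.injective

lemma IsOpenBisection.injOn_r {B : Set G} (h : IsOpenBisection B) : Set.InjOn r B :=
  Set.injOn_iff_injective.2 h.isOpenEmbedding_r.injective

/-- Compact open bisections. -/
def IsCOB (B : Set G) : Prop := IsCompact B ∧ IsOpenBisection B

lemma IsAmple.exists_isCOB (h : IsAmple G) {g : G} {U : Set G} (hU : IsOpen U) (hg : g ∈ U) :
    ∃ B, IsCOB B ∧ g ∈ B ∧ B ⊆ U :=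
  h.exists_subset_of_mem_open hg hU

lemma IsCOB.isClopen [T2Space G] {B : Set G} (hB : IsCOB B) : IsClopen B := ⟨hB.1.isClosed, hB.2.isOpen⟩

variable [IsTopologicalGroupoid G]

lemma continuous_inv' : Continuous (fun a : G => a⁻¹) := IsTopologicalGroupoid.continuous_inv

/-- The source is a⁻¹a, so its continuity follows from that of inversion and composition. -/
lemma continuous_src : Continuous (src : G → G) := by
  have h : ContinuousOn (fun p : G × G => p.1 * p.2) {p : G × G | src p.1 = rng p.2} :=
    IsTopologicalGroupoid.continuousOn_mul
  have h2 : Continuous (fun a : G => ((a⁻¹, a) : G × G)) := continuous_inv'.prodMk continuous_id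
  have := h.comp_continuous h2 (fun a => by simp [src_inv])
  exact this.congr fun a => inv_mul_self a

lemma continuous_s : Continuous (s : G → UnitSpace G) := continuous_src.subtype_mk _

lemma continuous_r : Continuous (r : G → UnitSpace G) :=
  (continuous_s.comp continuous_inv').congr fun a => by simp

/-- In an ample groupoid `s` and `r` are already continuous and open, so injectivity is all that is
left to check. -/
lemma IsAmple.isOpenBisection (h : IsAmple G) {B : Set G} (hB : IsOpen B) (hs : Set.InjOn s B)
    (hr : Set.InjOn r B) : IsOpenBisection B :=
  ⟨hB, .of_continuous_injective_isOpenMap (continuous_s.comp continuous_subtype_val)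
      (Set.injOn_iff_injective.1 hs) (h.isOpenMap_s.comp hB.isOpenMap_subtype_val),
    .of_continuous_injective_isOpenMap (continuous_r.comp continuous_subtype_val)
      (Set.injOn_iff_injective.1 hr) (h.isOpenMap_r.comp hB.isOpenMap_subtype_val)⟩

lemma IsCOB.subset (h : IsAmple G) {B C : Set G} (hB : IsCOB B) (hC : IsCompact C)
    (hCo : IsOpen C) (hCB : C ⊆ B) : IsCOB C :=
  ⟨hC, h.isOpenBisection hCo (hB.2.injOn_s.mono hCB) (hB.2.injOn_r.mono hCB)⟩

/-- If g and s(g) lie in one bisection, injectivity of `s` forces g = s(g). -/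
lemma IsAmple.isOpen_units (h : IsAmple G) : IsOpen {g : G | src g = g} := by
  rw [isOpen_iff_forall_mem_open]
  intro u hu
  obtain ⟨B, hB, huB, -⟩ := h.exists_isCOB isOpen_univ (Set.mem_univ u)
  refine ⟨B ∩ src ⁻¹' B, ?_, hB.2.isOpen.inter (hB.2.isOpen.preimage continuous_src), huB, ?_⟩
  · rintro g ⟨hg, hg'⟩
    exact hB.2.injOn_s hg' hg (Subtype.ext (src_src g))
  · show src u ∈ B
    rw [show src u = u from hu]; exact huB

lemma IsAmple.isOpenEmbedding_unit (h : IsAmple G) :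
    IsOpenEmbedding ((↑) : UnitSpace G → G) := h.isOpen_units.isOpenEmbedding_subtypeVal

lemma IsAmple.isCOB_unitSet (h : IsAmple G) {V : Set (UnitSpace G)} (hV : IsCompact V)
    (hVo : IsOpen V) : IsCOB (unitSet V) := by
  refine ⟨hV.image continuous_subtype_val,
    h.isOpenBisection (h.isOpenEmbedding_unit.isOpenMap _ hVo) ?_ ?_⟩
  · rintro _ ⟨u, -, rfl⟩ _ ⟨v, -, rfl⟩ huv
    simpa [Subtype.ext_iff] using huv
  · rintro _ ⟨u, -, rfl⟩ _ ⟨v, -, rfl⟩ huv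
    simpa [Subtype.ext_iff] using huv

lemma IsAmple.exists_compactOpen (h : IsAmple G) {u : UnitSpace G} {U : Set (UnitSpace G)}
    (hU : U ∈ 𝓝 u) : ∃ V, IsCompact V ∧ IsOpen V ∧ u ∈ V ∧ V ⊆ U := by
  obtain ⟨O, hOU, hO, huO⟩ := mem_nhds_iff.1 hU
  obtain ⟨B, hB, huB, hBO⟩ := h.exists_isCOB (h.isOpenEmbedding_unit.isOpenMap _ hO)
    (Set.mem_image_of_mem _ huO)
  refine ⟨(↑) ⁻¹' B, ?_, hB.2.isOpen.preimage continuous_subtype_val,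
    by simpa using huB, ?_⟩
  · refine h.isOpenEmbedding_unit.isInducing.isCompact_preimage_iff ?_ |>.2 hB.1
    exact hBO.trans (Set.image_subset_range _ _)
  · intro v hv
    obtain ⟨w, hw, hwv⟩ := hBO hv
    rw [← Subtype.val_injective hwv]; exact hOU hw

lemma IsCOB.setInv (h : IsAmple G) {B : Set G} (hB : IsCOB B) : IsCOB (setInv B) := by
  have e : ArrowGroupoid.setInv B = (fun a : G => a⁻¹) '' B := by
    ext g
    constructor
    · intro hg; exact ⟨g⁻¹, hg, by simp⟩
    · rintro ⟨b, hb, rfl⟩; simpa [ArrowGroupoid.setInv] using hb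
  refine ⟨e ▸ hB.1.image continuous_inv',
    h.isOpenBisection (hB.2.isOpen.preimage continuous_inv') ?_ ?_⟩
  · intro a ha b hb hab
    exact inv_injective' (hB.2.injOn_r ha hb (by simpa using hab))
  · intro a ha b hb hab
    exact inv_injective' (hB.2.injOn_s ha hb (by simpa using hab))

variable [T2Space G]

/-- Compactness: composable pairs form a closed set, since the unit space is Hausdorff. Openness:
with σ the section of `r` over r(B), an arrow g is in BC when r g ∈ r(B) and σ(r g)⁻¹g ∈ C, an open
condition. -/
lemma IsCOB.setMul (h : IsAmple G) {B C : Set G} (hB : IsCOB B) (hC : IsCOB C) :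
    IsCOB (setMul B C) := by
  have hm : ContinuousOn (fun p : G × G => p.1 * p.2) {p : G × G | src p.1 = rng p.2} :=
    IsTopologicalGroupoid.continuousOn_mul
  have e : ArrowGroupoid.setMul B C = (fun p : G × G => p.1 * p.2) ''
      ((B ×ˢ C) ∩ {p : G × G | s p.1 = r p.2}) := by
    ext g
    constructor
    · rintro ⟨b, hb, c, hc, hbc, rfl⟩; exact ⟨(b, c), ⟨⟨hb, hc⟩, hbc⟩, rfl⟩
    · rintro ⟨⟨b, c⟩, ⟨⟨hb, hc⟩, hbc⟩, rfl⟩; exact ⟨b, hb, c, hc, hbc, rfl⟩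
  have hcl : IsClosed {p : G × G | s p.1 = r p.2} :=
    isClosed_eq (continuous_s.comp continuous_fst) (continuous_r.comp continuous_snd)
  refine ⟨?_, h.isOpenBisection ?_ ?_ ?_⟩
  · rw [e]
    exact ((hB.1.prod hC.1).inter_right hcl).image_of_continuousOn
      (hm.mono fun p hp => s_eq_r_iff.1 hp.2)
  · rw [isOpen_iff_mem_nhds]
    rintro _ ⟨b, hb, c, hc, hbc, rfl⟩
    -- local section of the range map through `b`
    let σ : {u : UnitSpace G // u ∈ r '' B} → G := fun u => u.2.choose
    have hσB : ∀ u, σ u ∈ B := fun u => u.2.choose_spec.1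
    have hσr : ∀ u, r (σ u) = u := fun u => u.2.choose_spec.2
    have hσ : Continuous σ := by
      rw [continuous_def]
      intro O hO
      have : σ ⁻¹' O = Subtype.val ⁻¹' (r '' (B ∩ O)) := by
        ext u
        constructor
        · intro hu; exact ⟨σ u, ⟨hσB u, hu⟩, hσr u⟩
        · rintro ⟨g, ⟨hgB, hgO⟩, hgu⟩
          rw [Set.mem_preimage, hB.2.injOn_r (hσB u) hgB ((hσr u).trans hgu.symm)]
          exact hgO
      rw [this]
      exact (h.isOpenMap_r _ (hB.2.isOpen.inter hO)).preimage continuous_subtype_val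
    have hW : IsOpen (r ⁻¹' (r '' B) : Set G) :=
      (h.isOpenMap_r _ hB.2.isOpen).preimage continuous_r
    let τ : {g : G // g ∈ (r ⁻¹' (r '' B) : Set G)} → G := fun g => (σ ⟨r g.1, g.2⟩)⁻¹ * g.1
    have hτ : Continuous τ := by
      refine hm.comp_continuous (f := fun g : {g : G // g ∈ (r ⁻¹' (r '' B) : Set G)} =>
        (((σ ⟨r g.1, g.2⟩)⁻¹, g.1) : G × G)) ?_ ?_
      · exact (continuous_inv'.comp (hσ.comp
          ((continuous_r.comp continuous_subtype_val).subtype_mk _))).prodMk continuous_subtype_val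
      · intro g
        apply s_eq_r_iff.1
        rw [s_inv, hσr]
    have hO : IsOpen (Subtype.val '' (τ ⁻¹' C) : Set G) :=
      hW.isOpenMap_subtype_val _ (hC.2.isOpen.preimage hτ)
    refine Filter.mem_of_superset (hO.mem_nhds ?_) ?_
    · have hmem : b * c ∈ (r ⁻¹' (r '' B) : Set G) := ⟨b, hb, (r_mul hbc).symm⟩
      refine ⟨⟨b * c, hmem⟩, ?_, rfl⟩
      have : σ ⟨r (b * c), hmem⟩ = b :=
        hB.2.injOn_r (hσB _) hb ((hσr _).trans (r_mul hbc))
      show (σ ⟨r (b * c), hmem⟩)⁻¹ * (b * c) ∈ C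
      rw [this, inv_mul_cancel_left' hbc]; exact hc
    · rintro _ ⟨g, hg, rfl⟩
      refine ⟨σ ⟨r g.1, g.2⟩, hσB _, τ g, hg, ?_, ?_⟩
      · rw [r_mul (by rw [s_inv, hσr]), r_inv]
      · exact mul_inv_cancel_left' (hσr _)
  · rintro _ ⟨b, hb, c, hc, hbc, rfl⟩ _ ⟨b', hb', c', hc', hbc', rfl⟩ he
    rw [s_mul hbc, s_mul hbc'] at he
    obtain rfl := hC.2.injOn_s hc hc' he
    rw [hB.2.injOn_s hb hb' (hbc.trans hbc'.symm)]
  · rintro _ ⟨b, hb, c, hc, hbc, rfl⟩ _ ⟨b', hb', c', hc', hbc', rfl⟩ he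
    rw [r_mul hbc, r_mul hbc'] at he
    obtain rfl := hB.2.injOn_r hb hb' he
    rw [hC.2.injOn_r hc hc' (hbc.symm.trans hbc')]

/-- Morphisms of a compact open bisection with source and range close to a unit with trivial
isotropy are units. -/
lemma IsCOB.exists_nhds (h : IsAmple G) {B : Set G} (hB : IsCOB B) {u : UnitSpace G}
    (hu : {a : G | r a = u ∧ s a = u} = {(u : G)}) :
    ∃ W ∈ 𝓝 u, ∀ g ∈ B, s g ∈ W → r g ∈ W → g = (s g : G) := by
  -- Either u ∈ B, or the arrow of B starting at u ends elsewhere by trivial isotropy and W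
  -- separates its ends, or no arrow of B starts near u.
  by_cases huB : (u : G) ∈ B
  · refine ⟨(↑) ⁻¹' B, (hB.2.isOpen.preimage continuous_subtype_val).mem_nhds huB, ?_⟩
    intro g hg hgs _
    exact hB.2.injOn_s hg hgs (s_unit _).symm
  · by_cases hus : u ∈ s '' B
    · obtain ⟨g, hg, rfl⟩ := hus
      have hne : s g ≠ r g := by
        intro he
        have : g ∈ {a : G | r a = s g ∧ s a = s g} := ⟨he.symm, rfl⟩
        rw [hu] at this
        exact huB (this ▸ hg)
      obtain ⟨N₁, N₂, h1, h2, hm1, hm2, hd⟩ := t2_separation hne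
      refine ⟨N₁ ∩ s '' (B ∩ r ⁻¹' N₂), Filter.inter_mem (h1.mem_nhds hm1)
        ((h.isOpenMap_s _ (hB.2.isOpen.inter (h2.preimage continuous_r))).mem_nhds
          ⟨g, ⟨hg, hm2⟩, rfl⟩), ?_⟩
      rintro k hk ⟨-, k', ⟨hk', hk'2⟩, hkk'⟩ ⟨hk1, -⟩
      rw [hB.2.injOn_s hk' hk hkk'] at hk'2
      exact absurd hk'2 (Set.disjoint_left.1 hd hk1)
    · refine ⟨(s '' B)ᶜ, (hB.1.image continuous_s).isClosed.isOpen_compl.mem_nhds hus, ?_⟩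
      intro g hg hgs
      exact absurd ⟨g, hg, rfl⟩ hgs

end Topology

end ArrowGroupoid

/-! ### Regular representations described by matrix entries. -/

/-- Weighted composition operators on `ℓ²`: if `τ` is injective where the weight `a` does not
vanish, and `a` is bounded by `C`, then `f ↦ a · (f ∘ τ)` is bounded by `C`. -/
lemma exists_weightedComposition {X : Type*} (a : X → ℂ) (τ : X → X) {C : ℝ} (hC : 0 ≤ C)
    (ha : ∀ x, ‖a x‖ ≤ C) (hτ : Set.InjOn τ {x | a x ≠ 0}) :
    ∃ T : lp (fun _ : X => ℂ) 2 →L[ℂ] lp (fun _ : X => ℂ) 2,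
      ‖T‖ ≤ C ∧ ∀ f x, T f x = a x * f (τ x) := by
  classical
  have h2 : 0 < (2 : ℝ≥0∞).toReal := by norm_num
  have hbd : ∀ (f : lp (fun _ : X => ℂ) 2) (t : Finset X),
      ∑ x ∈ t, ‖a x * f (τ x)‖ ^ (2 : ℝ≥0∞).toReal ≤ (C * ‖f‖) ^ (2 : ℝ≥0∞).toReal := by
    intro f t
    rw [Real.mul_rpow hC (norm_nonneg _)]
    have h1 : ∑ x ∈ t, ‖a x * f (τ x)‖ ^ (2 : ℝ≥0∞).toReal =
        ∑ x ∈ t.filter (fun x => a x ≠ 0), ‖a x * f (τ x)‖ ^ (2 : ℝ≥0∞).toReal := by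
      refine (Finset.sum_filter_of_ne (p := fun x => a x ≠ 0) fun x _ hx hax => hx ?_).symm
      rw [hax]; simp
    have h3 : ∑ x ∈ t.filter (fun x => a x ≠ 0), ‖f (τ x)‖ ^ (2 : ℝ≥0∞).toReal ≤
        ‖f‖ ^ (2 : ℝ≥0∞).toReal := by
      rw [← Finset.sum_image (f := fun y => ‖f y‖ ^ (2 : ℝ≥0∞).toReal) (g := τ)]
      · exact lp.sum_rpow_le_norm_rpow h2 f _
      · intro x hx y hy hxy
        exact hτ (Finset.mem_filter.1 hx).2 (Finset.mem_filter.1 hy).2 hxy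
    rw [h1]
    refine le_trans ?_ (mul_le_mul_of_nonneg_left h3 (by positivity))
    rw [Finset.mul_sum]
    refine Finset.sum_le_sum fun x _ => ?_
    rw [norm_mul, Real.mul_rpow (norm_nonneg _) (norm_nonneg _)]
    gcongr
    exact ha x
  let L : lp (fun _ : X => ℂ) 2 →ₗ[ℂ] lp (fun _ : X => ℂ) 2 :=
    { toFun := fun f => ⟨fun x => a x * f (τ x), memℓp_gen' (hbd f)⟩
      map_add' := fun f g => by
        ext x
        show a x * (f (τ x) + g (τ x)) = a x * f (τ x) + a x * g (τ x)
        ring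
      map_smul' := fun c f => by
        ext x
        show a x * (c * f (τ x)) = c * (a x * f (τ x))
        ring }
  have hL : ∀ f, ‖L f‖ ≤ C * ‖f‖ := fun f =>
    lp.norm_le_of_forall_sum_le h2 (by positivity) (hbd f)
  exact ⟨L.mkContinuous C hL, L.mkContinuous_norm_le hC hL, fun f x => rfl⟩

namespace ArrowGroupoid

variable {G : Type*} [ArrowGroupoid G]

namespace RegularProduct

lemma component_mul (S T : RegularProduct G) (u : UnitSpace G) :
    (S * T).component u = S.component u * T.component u := rfl
lemma component_star (T : RegularProduct G) (u : UnitSpace G) :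
    (star T).component u = star (T.component u) := rfl
lemma ext_component {S T : RegularProduct G} (h : ∀ u, S.component u = T.component u) :
    S = T := lp.ext (funext h)

lemma norm_component_le (T : RegularProduct G) (u : UnitSpace G) : ‖T.component u‖ ≤ ‖T‖ :=
  lp.norm_apply_le_norm (E := fun u : UnitSpace G => FibreSpace u →L[ℂ] FibreSpace u)
    ENNReal.top_ne_zero T u

lemma exists_of_bounded {C : ℝ} (hC : 0 ≤ C)
    (T : ∀ u : UnitSpace G, FibreSpace u →L[ℂ] FibreSpace u) (hT : ∀ u, ‖T u‖ ≤ C) :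
    ∃ S : RegularProduct G, ‖S‖ ≤ C ∧ ∀ u, S.component u = T u := by
  have hmem : Memℓp T ∞ := memℓp_infty ⟨C, by rintro _ ⟨u, rfl⟩; exact hT u⟩
  exact ⟨(⟨T, hmem⟩ : lp (fun u : UnitSpace G => FibreSpace u →L[ℂ] FibreSpace u) ∞),
    lp.norm_le_of_forall_le (E := fun u : UnitSpace G => FibreSpace u →L[ℂ] FibreSpace u) hC hT,
    fun u => rfl⟩

/-- The matrix entries of a family of operators. -/
def entry (T : RegularProduct G) {u : UnitSpace G} (α γ : SourceFibre u) : ℂ :=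
  (T.component u (pointMass γ) : FibreSpace u) α

end RegularProduct

open Classical in
lemma pointMass_apply {u : UnitSpace G} (γ α : SourceFibre u) :
    (pointMass γ : FibreSpace u) α = if α = γ then 1 else 0 := by
  rw [pointMass, lp.single_apply, Pi.single_apply]

lemma norm_pointMass {u : UnitSpace G} (γ : SourceFibre u) : ‖pointMass γ‖ = 1 := by
  classical
  rw [pointMass, lp.norm_single (by norm_num)]; simp

lemma inner_pointMass_left {u : UnitSpace G} (γ : SourceFibre u) (f : FibreSpace u) :
    inner ℂ (pointMass γ) f = f γ := by
  classical
  rw [pointMass, lp.inner_single_left]; simp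

lemma inner_pointMass_right {u : UnitSpace G} (γ : SourceFibre u) (f : FibreSpace u) :
    inner ℂ f (pointMass γ) = star (f γ) := by
  rw [← inner_conj_symm, inner_pointMass_left]; rfl

lemma hasSum_pointMass {u : UnitSpace G} (f : FibreSpace u) :
    HasSum (fun γ => f γ • pointMass γ) f := by
  classical
  refine (lp.hasSum_single (p := 2) (by norm_num) f).congr_fun fun γ => ?_
  rw [pointMass, ← lp.single_smul]; simp

namespace RegularProduct

lemma entry_add (S T : RegularProduct G) {u : UnitSpace G} (α γ : SourceFibre u) :
    (S + T).entry α γ = S.entry α γ + T.entry α γ := rfl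
lemma entry_sub (S T : RegularProduct G) {u : UnitSpace G} (α γ : SourceFibre u) :
    (S - T).entry α γ = S.entry α γ - T.entry α γ := rfl
lemma entry_smul (c : ℂ) (T : RegularProduct G) {u : UnitSpace G} (α γ : SourceFibre u) :
    (c • T).entry α γ = c * T.entry α γ := rfl

lemma entry_star (T : RegularProduct G) {u : UnitSpace G} (α γ : SourceFibre u) :
    (star T).entry α γ = star (T.entry γ α) := by
  rw [entry, entry, component_star, ContinuousLinearMap.star_eq_adjoint, ← inner_pointMass_left,
    ContinuousLinearMap.adjoint_inner_right, inner_pointMass_right]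

lemma hasSum_component (T : RegularProduct G) {u : UnitSpace G} (f : FibreSpace u)
    (α : SourceFibre u) : HasSum (fun β => f β * T.entry α β) ((T.component u f : FibreSpace u) α) := by
  refine (((hasSum_pointMass f).mapL (T.component u)).mapL (lp.evalCLM ℂ _ 2 α)).congr_fun
    fun β => ?_
  rw [map_smul, map_smul]
  rfl

lemma hasSum_entry_mul (S T : RegularProduct G) {u : UnitSpace G} (α γ : SourceFibre u) :
    HasSum (fun β => S.entry α β * T.entry β γ) ((S * T).entry α γ) := by
  exact (hasSum_component S (T.component u (pointMass γ)) α).congr_fun fun β => mul_comm _ _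

lemma ext_entry {S T : RegularProduct G}
    (h : ∀ (u : UnitSpace G) (α γ : SourceFibre u), S.entry α γ = T.entry α γ) : S = T := by
  refine ext_component fun u => ContinuousLinearMap.ext fun f => lp.ext (funext fun α => ?_)
  have h1 := hasSum_component S f α
  simp only [h] at h1
  exact h1.unique (hasSum_component T f α)

lemma norm_entry_le (T : RegularProduct G) {u : UnitSpace G} (α γ : SourceFibre u) :
    ‖T.entry α γ‖ ≤ ‖T‖ := by
  calc ‖T.entry α γ‖ ≤ ‖T.component u (pointMass γ)‖ :=
        lp.norm_apply_le_norm (by norm_num) _ α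
    _ ≤ ‖T.component u‖ * ‖pointMass γ‖ := ContinuousLinearMap.le_opNorm _ _
    _ ≤ ‖T‖ := by rw [norm_pointMass, mul_one]; exact norm_component_le T u

/-- The diagonal of d⋆d consists of squared column norms, so a nonzero positive element has a
strictly positive diagonal entry. -/
lemma entry_star_mul_self (d : RegularProduct G) {u : UnitSpace G} (γ : SourceFibre u) :
    (star d * d).entry γ γ = ((‖d.component u (pointMass γ)‖ ^ 2 : ℝ) : ℂ) := by
  rw [entry, ← inner_pointMass_left, component_mul, component_star,
    ContinuousLinearMap.star_eq_adjoint]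
  show inner ℂ (pointMass γ) ((ContinuousLinearMap.adjoint (d.component u))
    (d.component u (pointMass γ))) = _
  rw [ContinuousLinearMap.adjoint_inner_right, inner_self_eq_norm_sq_to_K]
  simp

/-- The matrix of `T` is given by the function `w` on the groupoid. -/
def HasMatrix (w : G → ℂ) (T : RegularProduct G) : Prop :=
  ∀ (u : UnitSpace G) (α γ : SourceFibre u), T.entry α γ = w (α.1 * γ.1⁻¹)

lemma HasMatrix.unique {w : G → ℂ} {S T : RegularProduct G} (hS : HasMatrix w S)
    (hT : HasMatrix w T) : S = T :=
  ext_entry fun u α γ => (hS u α γ).trans (hT u α γ).symm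

lemma HasMatrix.add {w w' : G → ℂ} {S T : RegularProduct G} (hS : HasMatrix w S)
    (hT : HasMatrix w' T) : HasMatrix (w + w') (S + T) := fun u α γ => by
  rw [entry_add, hS, hT]; rfl

lemma HasMatrix.sub {w w' : G → ℂ} {S T : RegularProduct G} (hS : HasMatrix w S)
    (hT : HasMatrix w' T) : HasMatrix (w - w') (S - T) := fun u α γ => by
  rw [entry_sub, hS, hT]; rfl

lemma HasMatrix.smul {w : G → ℂ} {T : RegularProduct G} (c : ℂ) (hT : HasMatrix w T) :
    HasMatrix (c • w) (c • T) := fun u α γ => by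
  rw [entry_smul, hT]; rfl

lemma hasMatrix_zero : HasMatrix (0 : G → ℂ) 0 := fun _ _ _ => rfl

lemma fibre_inv_mem {u : UnitSpace G} (α γ : SourceFibre u) : s α.1 = r γ.1⁻¹ := by
  rw [α.2, r_inv, γ.2]

lemma HasMatrix.star {w : G → ℂ} {T : RegularProduct G} (hT : HasMatrix w T) :
    HasMatrix (fun g => star (w g⁻¹)) (star T) := fun u α γ => by
  show _ = Star.star (w (α.1 * γ.1⁻¹)⁻¹)
  rw [entry_star, hT, mul_inv_rev' (fibre_inv_mem α γ), inv_inv']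

/-- A bounded function supported on a set where `r` and `s` are injective is the matrix of a
family of operators. -/
lemma exists_hasMatrix (w : G → ℂ) {C : ℝ} (hC : 0 ≤ C) (hw : ∀ g, ‖w g‖ ≤ C) {B : Set G}
    (hs : Set.InjOn s B) (hr : Set.InjOn r B) (hB : ∀ g, w g ≠ 0 → g ∈ B) :
    ∃ T : RegularProduct G, ‖T‖ ≤ C ∧ HasMatrix w T := by
  classical
  have key : ∀ u : UnitSpace G, ∃ T : FibreSpace u →L[ℂ] FibreSpace u, ‖T‖ ≤ C ∧
      ∀ α γ : SourceFibre u, (T (pointMass γ) : FibreSpace u) α = w (α.1 * γ.1⁻¹) := by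
    intro u
    -- The only arrow of B that can contribute to row α. The default r α keeps e(α)⁻¹α composable,
    -- and w vanishes there, since otherwise the unit r α would itself lie in B.
    let e : SourceFibre u → G := fun α =>
      if h : ∃ b ∈ B, r b = r α.1 then h.choose else (r α.1 : G)
    have her : ∀ α, r (e α) = r α.1 := by
      intro α
      by_cases h : ∃ b ∈ B, r b = r α.1
      · simp only [e, dif_pos h]; exact h.choose_spec.2
      · simp only [e, dif_neg h, r_unit]
    have heq : ∀ (α : SourceFibre u) (b : G), b ∈ B → r b = r α.1 → e α = b := by
      intro α b hb hbα
      have h : ∃ b ∈ B, r b = r α.1 := ⟨b, hb, hbα⟩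
      simp only [e, dif_pos h]
      exact hr h.choose_spec.1 hb (h.choose_spec.2.trans hbα.symm)
    have hcomp : ∀ α, s (e α)⁻¹ = r α.1 := fun α => by rw [s_inv, her]
    let τ : SourceFibre u → SourceFibre u := fun α =>
      ⟨(e α)⁻¹ * α.1, (s_mul (hcomp α)).trans α.2⟩
    have hτ : Set.InjOn τ {α | w (e α) ≠ 0} := by
      intro α hα β hβ hαβ
      have h1 : (e α)⁻¹ * α.1 = (e β)⁻¹ * β.1 := congrArg Subtype.val hαβ
      have h2 := congrArg r h1
      rw [r_mul (hcomp α), r_mul (hcomp β), r_inv, r_inv] at h2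
      have h3 := hs (hB _ hα) (hB _ hβ) h2
      have h4 := mul_inv_cancel_left' (her α)
      have h5 := mul_inv_cancel_left' (her β)
      rw [h1, h3, h5] at h4
      exact Subtype.ext h4.symm
    obtain ⟨T, hT, hTf⟩ := exists_weightedComposition (fun α => w (e α)) τ hC
      (fun α => hw _) hτ
    refine ⟨T, hT, fun α γ => ?_⟩
    rw [hTf, pointMass_apply]
    by_cases h : τ α = γ
    · rw [if_pos h, mul_one]
      have h1 : (e α)⁻¹ * α.1 = γ.1 := congrArg Subtype.val h
      rw [← h1, mul_inv_rev' (hcomp α), inv_inv', mul_inv_cancel_left' (her α).symm]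
    · rw [if_neg h, mul_zero]
      by_contra hne
      have hmem := hB _ (Ne.symm hne)
      have hr' : r (α.1 * γ.1⁻¹) = r α.1 := r_mul (fibre_inv_mem α γ)
      have h1 := heq α _ hmem hr'
      apply h
      apply Subtype.ext
      show (e α)⁻¹ * α.1 = γ.1
      rw [h1, mul_inv_rev' (fibre_inv_mem α γ), inv_inv',
        inv_mul_cancel_right' (by rw [γ.2, α.2])]
  choose T hT hTm using key
  obtain ⟨S, hS, hST⟩ := exists_of_bounded hC T hT
  refine ⟨S, hS, fun u α γ => ?_⟩
  rw [entry, hST, hTm]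

/-- Only η = αγ⁻¹ contributes to the coefficient of ηγ at α. -/
lemma _root_.ArrowGroupoid.IsRegularRep.hasMatrix {f : G → ℂ} {T : RegularProduct G}
    (h : IsRegularRep f T) : HasMatrix f T := by
  intro u α γ
  have h1 : HasSum (fun η : {η : G // s η = r γ.1} =>
      f η.1 * (pointMass (fibreMul γ η) : FibreSpace u) α) (T.entry α γ) :=
    ((h u γ).mapL (lp.evalCLM ℂ _ 2 α)).congr_fun fun η => rfl
  have hη : s (α.1 * γ.1⁻¹) = r γ.1 := by rw [s_mul (fibre_inv_mem α γ), s_inv]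
  have hα : α = fibreMul γ ⟨α.1 * γ.1⁻¹, hη⟩ := by
    apply Subtype.ext
    show _ = α.1 * γ.1⁻¹ * γ.1
    rw [inv_mul_cancel_right' (by rw [γ.2, α.2])]
  have h2 := hasSum_single (f := fun η : {η : G // s η = r γ.1} =>
    f η.1 * (pointMass (fibreMul γ η) : FibreSpace u) α) ⟨α.1 * γ.1⁻¹, hη⟩ ?_
  · refine (h1.unique h2).trans ?_
    rw [pointMass_apply, if_pos hα, mul_one]
  · intro η hne
    rw [pointMass_apply, if_neg, mul_zero]
    intro hα
    apply hne
    apply Subtype.ext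
    show η.1 = α.1 * γ.1⁻¹
    rw [hα]
    exact (mul_inv_cancel_right' η.2).symm

/-- Injectivity of `s` on the support leaves at most one nonzero term in each column, so convergence
in ℓ² is automatic. -/
lemma HasMatrix.isRegularRep {f : G → ℂ} {T : RegularProduct G} (h : HasMatrix f T) {B : Set G}
    (hs : Set.InjOn s B) (hB : ∀ g, f g ≠ 0 → g ∈ B) : IsRegularRep f T := by
  intro u γ
  have hcol : ∀ α : SourceFibre u, (T.component u (pointMass γ) : FibreSpace u) α =
      f (α.1 * γ.1⁻¹) := fun α => h u α γ
  by_cases hex : ∃ η : {η : G // s η = r γ.1}, f η.1 ≠ 0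
  · obtain ⟨η, hη⟩ := hex
    have h2 := hasSum_single (f := fun η : {η : G // s η = r γ.1} =>
      f η.1 • (pointMass (fibreMul γ η) : FibreSpace u)) η ?_
    · convert h2 using 1
      refine lp.ext (funext fun α => ?_)
      rw [hcol]
      show _ = f η.1 * (pointMass _ : FibreSpace u) α
      rw [pointMass_apply]
      split_ifs with hα
      · rw [hα, mul_one]
        show f (η.1 * γ.1 * γ.1⁻¹) = _
        rw [mul_inv_cancel_right' η.2]
      · rw [mul_zero]
        by_contra hne
        have h3 : s (α.1 * γ.1⁻¹) = s η.1 := by rw [s_mul (fibre_inv_mem α γ), s_inv, η.2]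
        have h4 := hs (hB _ hne) (hB _ hη) h3
        apply hα
        apply Subtype.ext
        show _ = η.1 * γ.1
        rw [← h4, inv_mul_cancel_right' (by rw [γ.2, α.2])]
    · intro η' hne
      by_contra hne'
      have : f η'.1 ≠ 0 := fun h0 => hne' (by simp only [h0, zero_smul])
      exact hne (Subtype.ext (hs (hB _ this) (hB _ hη) (η'.2.trans η.2.symm)))
  · push Not at hex
    have h0 : T.component u (pointMass γ) = 0 := by
      refine lp.ext (funext fun α => ?_)
      rw [hcol]
      exact hex ⟨α.1 * γ.1⁻¹, by rw [s_mul (fibre_inv_mem α γ), s_inv]⟩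
    rw [h0]
    simp only [hex, zero_smul]
    exact hasSum_zero

/-- Product of two matrices supported on sets on which `r` is injective. -/
lemma HasMatrix.mul_of_left {w w' w'' : G → ℂ} {S T : RegularProduct G} (hS : HasMatrix w S)
    (hT : HasMatrix w' T) {B : Set G} (hr : Set.InjOn r B) (hB : ∀ g, w g ≠ 0 → g ∈ B)
    (hw : ∀ a b, s a = r b → a ∈ B → w'' (a * b) = w a * w' b)
    (hw0 : ∀ g, (∀ b ∈ B, r b ≠ r g) → w'' g = 0) :
    HasMatrix w'' (S * T) := by
  intro u α γ
  refine (hasSum_entry_mul S T α γ).unique ?_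
  by_cases hex : ∃ b ∈ B, r b = r α.1
  · obtain ⟨b, hb, hbα⟩ := hex
    have hbc : s b⁻¹ = r α.1 := by rw [s_inv, hbα]
    -- Row α of S can be nonzero only at this index, so the matrix product has one term.
    let β : SourceFibre u := ⟨b⁻¹ * α.1, (s_mul hbc).trans α.2⟩
    have h1 : α.1 * β.1⁻¹ = b := by
      show α.1 * (b⁻¹ * α.1)⁻¹ = b
      rw [mul_inv_rev' hbc, inv_inv', mul_inv_cancel_left' hbα.symm]
    have h2 := hasSum_single (f := fun β => S.entry α β * T.entry β γ) β ?_
    · convert h2 using 1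
      have hbβ : s b = r (β.1 * γ.1⁻¹) := by
        rw [r_mul (fibre_inv_mem β γ)]
        show s b = r (b⁻¹ * α.1)
        rw [r_mul hbc, r_inv]
      have h3 : b * (β.1 * γ.1⁻¹) = α.1 * γ.1⁻¹ := by
        show b * (b⁻¹ * α.1 * γ.1⁻¹) = _
        rw [mul_assoc' hbc (fibre_inv_mem α γ), mul_inv_cancel_left']
        rw [r_mul (fibre_inv_mem α γ), hbα]
      rw [hS, hT, h1, ← hw b _ hbβ hb, h3]
    · intro β' hne
      by_contra hne'
      have h3 : w (α.1 * β'.1⁻¹) ≠ 0 := fun h0 => hne' (by rw [hS, h0, zero_mul])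
      have h4 : α.1 * β'.1⁻¹ = b :=
        hr (hB _ h3) hb ((r_mul (fibre_inv_mem α β')).trans hbα.symm)
      apply hne
      apply Subtype.ext
      show β'.1 = b⁻¹ * α.1
      rw [← h4, mul_inv_rev' (fibre_inv_mem α β'), inv_inv',
        inv_mul_cancel_right' (by rw [β'.2, α.2])]
  · push Not at hex
    have h0 : w'' (α.1 * γ.1⁻¹) = 0 := hw0 _ fun b hb => by
      rw [r_mul (fibre_inv_mem α γ)]; exact hex b hb
    rw [h0]
    have : ∀ β, S.entry α β * T.entry β γ = 0 := by
      intro β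
      rw [hS]
      by_contra hne
      exact hex _ (hB _ (left_ne_zero_of_mul hne)) (r_mul (fibre_inv_mem α β))
    simp only [this]
    exact hasSum_zero

end RegularProduct

end ArrowGroupoid

/-! ### Indicators of compact open bisections and their dense span. -/

namespace ArrowGroupoid

open RegularProduct

variable {G : Type*} [ArrowGroupoid G]

lemma setMul_unitSet_left (V : Set (UnitSpace G)) (B : Set G) :
    setMul (unitSet V) B = {g | g ∈ B ∧ r g ∈ V} := by
  ext g
  constructor
  · rintro ⟨_, ⟨u, hu, rfl⟩, c, hc, huc, rfl⟩
    rw [s_unit] at huc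
    rw [unit_mul huc.symm]
    exact ⟨hc, huc ▸ hu⟩
  · rintro ⟨hg, hr⟩
    exact ⟨_, ⟨r g, hr, rfl⟩, g, hg, by simp, unit_mul rfl⟩

lemma setMul_unitSet_unitSet (V W : Set (UnitSpace G)) :
    setMul (unitSet V) (unitSet W) = unitSet (V ∩ W) := by
  rw [setMul_unitSet_left]
  ext g
  constructor
  · rintro ⟨⟨u, hu, rfl⟩, hr⟩
    rw [r_unit] at hr
    exact ⟨u, ⟨hr, hu⟩, rfl⟩
  · rintro ⟨u, hu, rfl⟩
    exact ⟨⟨u, hu.2, rfl⟩, by rw [r_unit]; exact hu.1⟩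

lemma setInv_unitSet (V : Set (UnitSpace G)) : setInv (unitSet V) = unitSet V := by
  ext g
  constructor
  · rintro ⟨u, hu, hug⟩
    rw [← inv_inv' g, ← hug, inv_unit]
    exact ⟨u, hu, rfl⟩
  · rintro ⟨u, hu, rfl⟩
    exact ⟨u, hu, (inv_unit u).symm⟩

lemma setMul_setInv_self {B : Set G} (hr : Set.InjOn r B) :
    setMul (setInv B) B = unitSet (s '' B) := by
  ext g
  constructor
  · rintro ⟨b, hb, c, hc, hbc, rfl⟩
    have : b⁻¹ = c := hr hb hc (by rw [r_inv, hbc])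
    rw [← this, mul_inv_eq]
    exact ⟨r b, ⟨c, hc, by rw [← this, s_inv]⟩, rfl⟩
  · rintro ⟨_, ⟨b, hb, rfl⟩, rfl⟩
    exact ⟨b⁻¹, by simpa [setInv] using hb, b, hb, by simp, inv_mul_eq b⟩

/-- A factorisation g = bc with b ∈ B is unique because `r` is injective on B, so the convolution
takes only the values 0 and 1. -/
lemma hasMatrix_mul_indicator {B C : Set G} {S T : RegularProduct G} (hr : Set.InjOn r B)
    (hS : HasMatrix (B.indicator 1) S) (hT : HasMatrix (C.indicator 1) T) :
    HasMatrix ((setMul B C).indicator 1) (S * T) := by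
  classical
  refine hS.mul_of_left hT hr (fun g hg => Set.mem_of_indicator_ne_zero hg) ?_ ?_
  · intro a b hab ha
    rw [Set.indicator_of_mem ha, Pi.one_apply, one_mul, Set.indicator_apply, Set.indicator_apply]
    congr 1
    refine propext ⟨?_, fun hb => ⟨a, ha, b, hb, hab, rfl⟩⟩
    rintro ⟨a', ha', b', hb', hab', he⟩
    have h1 := congrArg r he
    rw [r_mul hab, r_mul hab'] at h1
    obtain rfl := hr ha' ha h1
    have h2 := inv_mul_cancel_left' hab'
    rw [he, inv_mul_cancel_left' hab] at h2
    rwa [h2]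
  · intro g hg
    refine Set.indicator_of_notMem ?_ _
    rintro ⟨a, ha, b, hb, hab, rfl⟩
    exact hg a ha (r_mul hab).symm

lemma hasMatrix_star_indicator {B : Set G} {T : RegularProduct G}
    (hT : HasMatrix (B.indicator 1) T) : HasMatrix ((setInv B).indicator 1) (star T) := by
  classical
  convert hT.star using 1
  ext g
  simp only [Set.indicator_apply, setInv, Set.mem_ofPred_eq, Pi.one_apply]
  split_ifs <;> simp

variable [TopologicalSpace G]

lemma coe_mul' (a b : reducedCStar G) :
    ((a * b : reducedCStar G) : RegularProduct G) = (a : RegularProduct G) * b := rfl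
lemma coe_smul' (c : ℂ) (a : reducedCStar G) :
    ((c • a : reducedCStar G) : RegularProduct G) = c • (a : RegularProduct G) := rfl
lemma coe_star' (a : reducedCStar G) :
    ((star a : reducedCStar G) : RegularProduct G) = star (a : RegularProduct G) := rfl
open Classical in
/-- The element of the reduced C⋆-algebra given by the indicator function of a set. -/
def indicatorOp (B : Set G) : reducedCStar G :=
  if h : ∃ a : reducedCStar G, HasMatrix (B.indicator 1) (a : RegularProduct G) then h.choose
  else 0

lemma indicatorOp_empty : indicatorOp (∅ : Set G) = 0 := by
  have h : HasMatrix ((∅ : Set G).indicator 1) ((0 : reducedCStar G) : RegularProduct G) := by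
    rw [Set.indicator_empty]; exact hasMatrix_zero
  have he : ∃ a : reducedCStar G, HasMatrix ((∅ : Set G).indicator 1) (a : RegularProduct G) :=
    ⟨0, h⟩
  rw [indicatorOp, dif_pos he]
  exact Subtype.ext (he.choose_spec.unique h)

/-- The span of the indicator functions of compact open bisections. -/
def indicatorSpan (G : Type*) [ArrowGroupoid G] [TopologicalSpace G] :
    Submodule ℂ (RegularProduct G) :=
  Submodule.span ℂ {T | ∃ B : Set G, IsCOB B ∧ HasMatrix (B.indicator 1) T}

lemma IsAmple.exists_compactOpen_superset (h : IsAmple G) {C : Set G} (hC : IsCompact C) :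
    ∃ K, IsCompact K ∧ IsOpen K ∧ C ⊆ K := by
  refine hC.induction_on (p := fun C => ∃ K, IsCompact K ∧ IsOpen K ∧ C ⊆ K) ?_ ?_ ?_ ?_
  · exact ⟨∅, isCompact_empty, isOpen_empty, subset_rfl⟩
  · rintro S T hST ⟨K, h1, h2, h3⟩
    exact ⟨K, h1, h2, hST.trans h3⟩
  · rintro S T ⟨K, h1, h2, h3⟩ ⟨L, h1', h2', h3'⟩
    exact ⟨K ∪ L, h1.union h1', h2.union h2', Set.union_subset_union h3 h3'⟩
  · intro x _
    obtain ⟨B, hB, hxB, -⟩ := h.exists_isCOB isOpen_univ (Set.mem_univ x)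
    exact ⟨B, mem_nhdsWithin_of_mem_nhds (hB.2.isOpen.mem_nhds hxB), B, hB.1, hB.2.isOpen,
      subset_rfl⟩

section

variable [IsTopologicalGroupoid G]

lemma star_mem_indicatorSpan (h : IsAmple G) {T : RegularProduct G} (hT : T ∈ indicatorSpan G) :
    star T ∈ indicatorSpan G := by
  induction hT using Submodule.span_induction with
  | mem T hT =>
    obtain ⟨B, hB, hT⟩ := hT
    exact Submodule.subset_span ⟨_, hB.setInv h, hasMatrix_star_indicator hT⟩
  | zero => rw [star_zero]; exact zero_mem _
  | add T T' _ _ h1 h2 => rw [star_add]; exact add_mem h1 h2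
  | smul c T _ h1 => rw [star_smul]; exact Submodule.smul_mem _ _ h1

end

section

variable [T2Space G]

/-- Compact open sets are clopen in a Hausdorff space, so the indicator belongs to C_c(G). -/
lemma exists_indicatorOp {B : Set G} (hB : IsCOB B) :
    ∃ a : reducedCStar G, HasMatrix (B.indicator 1) (a : RegularProduct G) := by
  have hsupp : ∀ g, B.indicator (1 : G → ℂ) g ≠ 0 → g ∈ B :=
    fun g hg => Set.mem_of_indicator_ne_zero hg
  have hcont : Continuous (B.indicator (1 : G → ℂ)) := by
    exact (continuous_const (y := (1 : ℂ))).indicator (by simp [hB.isClopen.frontier_eq])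
  obtain ⟨T, -, hT⟩ := exists_hasMatrix (B.indicator (1 : G → ℂ)) zero_le_one (by
    classical
    intro g
    rw [Set.indicator_apply]
    split_ifs <;> simp) hB.2.injOn_s hB.2.injOn_r hsupp
  refine ⟨⟨T, subset_closure (NonUnitalStarAlgebra.subset_adjoin ℂ _ ?_)⟩, hT⟩
  exact ⟨⟨⟨B.indicator 1, hcont⟩, HasCompactSupport.intro hB.1
    fun g hg => Set.indicator_of_notMem hg _⟩, hT.isRegularRep hB.2.injOn_s hsupp⟩

lemma hasMatrix_indicatorOp {B : Set G} (hB : IsCOB B) :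
    HasMatrix (B.indicator 1) (indicatorOp B : RegularProduct G) := by
  rw [indicatorOp, dif_pos (exists_indicatorOp hB)]
  exact (exists_indicatorOp hB).choose_spec

lemma eq_indicatorOp {B : Set G} (hB : IsCOB B) {a : reducedCStar G}
    (ha : HasMatrix (B.indicator 1) (a : RegularProduct G)) : a = indicatorOp B :=
  Subtype.ext (ha.unique (hasMatrix_indicatorOp hB))

lemma indicatorOp_union {B C : Set G} (hB : IsCOB B) (hC : IsCOB C) (hBC : IsCOB (B ∪ C))
    (hd : Disjoint B C) : indicatorOp (B ∪ C) = indicatorOp B + indicatorOp C := by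
  refine (eq_indicatorOp hBC ?_).symm
  rw [Set.indicator_union_of_disjoint hd]
  exact (hasMatrix_indicatorOp hB).add (hasMatrix_indicatorOp hC)

variable [IsTopologicalGroupoid G]

lemma indicatorOp_mul (h : IsAmple G) {B C : Set G} (hB : IsCOB B) (hC : IsCOB C) :
    indicatorOp B * indicatorOp C = indicatorOp (setMul B C) :=
  eq_indicatorOp (hB.setMul h hC) (hasMatrix_mul_indicator hB.2.injOn_r (hasMatrix_indicatorOp hB)
    (hasMatrix_indicatorOp hC))

lemma star_indicatorOp (h : IsAmple G) {B : Set G} (hB : IsCOB B) :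
    star (indicatorOp B) = indicatorOp (setInv B) :=
  eq_indicatorOp (hB.setInv h) (hasMatrix_star_indicator (hasMatrix_indicatorOp hB))

lemma mul_mem_indicatorSpan (h : IsAmple G) {S T : RegularProduct G} (hS : S ∈ indicatorSpan G)
    (hT : T ∈ indicatorSpan G) : S * T ∈ indicatorSpan G := by
  induction hS using Submodule.span_induction with
  | mem S hS =>
    obtain ⟨B, hB, hS⟩ := hS
    induction hT using Submodule.span_induction with
    | mem T hT =>
      obtain ⟨C, hC, hT⟩ := hT
      exact Submodule.subset_span ⟨_, hB.setMul h hC, hasMatrix_mul_indicator hB.2.injOn_r hS hT⟩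
    | zero => rw [mul_zero]; exact zero_mem _
    | add T T' _ _ h1 h2 => rw [mul_add]; exact add_mem h1 h2
    | smul c T _ h1 => rw [mul_smul_comm]; exact Submodule.smul_mem _ _ h1
  | zero => rw [zero_mul]; exact zero_mem _
  | add T T' _ _ h1 h2 => rw [add_mul]; exact add_mem h1 h2
  | smul c T _ h1 => rw [smul_mul_assoc]; exact Submodule.smul_mem _ _ h1

/-- Near each point f is within ε of a constant; disjoint pieces glue such constants to a step
function on B. -/
lemma exists_mem_indicatorSpan_approx (h : IsAmple G) {B : Set G} (hB : IsCOB B) {f : G → ℂ}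
    (hf : Continuous f) {ε : ℝ} (hε : 0 < ε) :
    ∃ T ∈ indicatorSpan G, ∃ w, HasMatrix w T ∧ (∀ g, g ∉ B → w g = 0) ∧
      ∀ g ∈ B, ‖f g - w g‖ ≤ ε := by
  refine compactOpen_induction (fun L => ∃ T ∈ indicatorSpan G, ∃ w, HasMatrix w T ∧
    (∀ g, g ∉ L → w g = 0) ∧ ∀ g ∈ L, ‖f g - w g‖ ≤ ε) ?_ ?_ hB.1 hB.2.isOpen ?_
  · exact ⟨0, zero_mem _, 0, hasMatrix_zero, fun _ _ => rfl, fun g hg => hg.elim⟩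
  · rintro K L - - - - hd ⟨T, hT, w, hw, hw0, hwf⟩ ⟨T', hT', w', hw', hw0', hwf'⟩
    refine ⟨T + T', add_mem hT hT', w + w', hw.add hw', ?_, ?_⟩
    · intro g hg
      rw [Pi.add_apply, hw0 g fun h => hg (Or.inl h), hw0' g fun h => hg (Or.inr h), add_zero]
    · rintro g (hg | hg)
      · rw [Pi.add_apply, hw0' g (Set.disjoint_left.1 hd hg), add_zero]; exact hwf g hg
      · rw [Pi.add_apply, hw0 g (Set.disjoint_right.1 hd hg), zero_add]; exact hwf' g hg
  · intro x hx
    obtain ⟨U, hU, hxU, hUf⟩ := h.exists_isCOB (U := {g | ‖f g - f x‖ < ε})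
      (isOpen_lt (by fun_prop) continuous_const) (show ‖f x - f x‖ < ε by simpa using hε)
    refine ⟨U, hU.1, hU.2.isOpen, hxU, ?_⟩
    intro L hLU _ hL hLo
    have hLB := hU.subset h hL hLo hLU
    refine ⟨f x • (indicatorOp L : RegularProduct G), Submodule.smul_mem _ _
      (Submodule.subset_span ⟨L, hLB, hasMatrix_indicatorOp hLB⟩), _,
      (hasMatrix_indicatorOp hLB).smul (f x), ?_, ?_⟩
    · intro g hg
      simp [Set.indicator_of_notMem hg]
    · intro g hg
      have : ‖f g - f x‖ < ε := hUf (hLU hg)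
      simpa [Set.indicator_of_mem hg] using this.le

/-- Cutting K into disjoint pieces inside bisections reduces to one bisection, where a uniform bound
on a function bounds the operator norm. -/
lemma exists_mem_closure_indicatorSpan (h : IsAmple G) {f : G → ℂ} (hf : Continuous f) {K : Set G}
    (hK : IsCompact K) (hKo : IsOpen K) :
    ∃ T ∈ (indicatorSpan G).topologicalClosure, HasMatrix (K.indicator f) T := by
  refine compactOpen_induction (fun L => ∃ T ∈ (indicatorSpan G).topologicalClosure,
    HasMatrix (L.indicator f) T) ?_ ?_ hK hKo ?_
  · exact ⟨0, zero_mem _, by rw [Set.indicator_empty]; exact hasMatrix_zero⟩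
  · rintro K L - - - - hd ⟨T, hT, hw⟩ ⟨T', hT', hw'⟩
    refine ⟨T + T', add_mem hT hT', ?_⟩
    rw [Set.indicator_union_of_disjoint hd]
    exact hw.add hw'
  · intro x _
    obtain ⟨B, hB, hxB, -⟩ := h.exists_isCOB isOpen_univ (Set.mem_univ x)
    refine ⟨B, hB.1, hB.2.isOpen, hxB, ?_⟩
    intro L hLB _ hL hLo
    have hLC := hB.subset h hL hLo hLB
    obtain ⟨C, hC⟩ := hL.exists_bound_of_continuousOn hf.continuousOn
    obtain ⟨T, -, hT⟩ := exists_hasMatrix (L.indicator f) (le_max_left 0 C) (by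
      classical
      intro g
      rw [Set.indicator_apply]
      split_ifs with hg
      · exact (hC g hg).trans (le_max_right _ _)
      · simp) hLC.2.injOn_s hLC.2.injOn_r fun g hg => Set.mem_of_indicator_ne_zero hg
    refine ⟨T, ?_, hT⟩
    rw [← SetLike.mem_coe, Submodule.topologicalClosure_coe, Metric.mem_closure_iff]
    intro ε hε
    obtain ⟨T', hT', w, hw, hw0, hwf⟩ := exists_mem_indicatorSpan_approx h hLC hf (half_pos hε)
    refine ⟨T', hT', ?_⟩
    obtain ⟨D, hD, hDm⟩ := exists_hasMatrix (L.indicator f - w) (half_pos hε).le (by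
      intro g
      by_cases hg : g ∈ L
      · rw [Pi.sub_apply, Set.indicator_of_mem hg]; exact hwf g hg
      · rw [Pi.sub_apply, Set.indicator_of_notMem hg, hw0 g hg]; simpa using (half_pos hε).le)
      hLC.2.injOn_s hLC.2.injOn_r (by
        intro g hne
        by_contra hg
        apply hne
        rw [Pi.sub_apply, Set.indicator_of_notMem hg, hw0 g hg, sub_zero])
    rw [dist_eq_norm, (hT.sub hw).unique hDm]
    linarith

/-- The indicator functions of compact open bisections span a dense subspace. -/
lemma mem_closure_indicatorSpan (h : IsAmple G) {T : RegularProduct G} (hT : T ∈ reducedCStar G) :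
    T ∈ closure (indicatorSpan G : Set (RegularProduct G)) := by
  -- The span is a ⋆-subalgebra, so only the generators from C_c(G) need to be placed in its
  -- closure.
  let N : NonUnitalStarSubalgebra ℂ (RegularProduct G) :=
    { indicatorSpan G with
      mul_mem' := fun hS hT => mul_mem_indicatorSpan h hS hT
      star_mem' := fun hT => star_mem_indicatorSpan h hT }
  have hle : reducedCStar G ≤ N.topologicalClosure := by
    refine NonUnitalStarSubalgebra.topologicalClosure_minimal _
      (NonUnitalStarAlgebra.adjoin_le ?_) (NonUnitalStarSubalgebra.isClosed_topologicalClosure _)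
    rintro T ⟨f, hf⟩
    obtain ⟨K, hK, hKo, hfK⟩ := h.exists_compactOpen_superset f.hasCompactSupport.isCompact
    obtain ⟨T', hT', hT'm⟩ := exists_mem_closure_indicatorSpan h (map_continuous f) hK hKo
    have : K.indicator f = f := Set.indicator_eq_self.2 ((subset_tsupport f).trans hfK)
    rw [this] at hT'm
    rw [hf.hasMatrix.unique hT'm]
    exact hT'
  exact hle hT

/-- Approximation of elements of the reduced C⋆-algebra by elements of the span. -/
lemma dense_indicatorSpan (h : IsAmple G) :
    Dense {a : reducedCStar G | (a : RegularProduct G) ∈ indicatorSpan G} := by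
  intro a
  rw [Metric.mem_closure_iff]
  intro ε hε
  obtain ⟨T, hT, hd⟩ := Metric.mem_closure_iff.1 (mem_closure_indicatorSpan h a.2) ε hε
  have hTA : T ∈ reducedCStar G := by
    have : indicatorSpan G ≤ (reducedCStar G).toNonUnitalSubalgebra.toSubmodule := by
      refine Submodule.span_le.2 ?_
      rintro S ⟨B, hB, hS⟩
      rw [hS.unique (hasMatrix_indicatorOp hB)]
      exact (indicatorOp B).2
    exact this hT
  exact ⟨⟨T, hTA⟩, hT, hd⟩

end

end ArrowGroupoid

/-! ### Unit space projections: fullness and cut-downs. -/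

namespace ArrowGroupoid

open RegularProduct CStarNotions

variable {G : Type*} [ArrowGroupoid G] [TopologicalSpace G]

/-- The projection of the reduced C⋆-algebra given by a compact open set of units. -/
def unitProj (V : Set (UnitSpace G)) : reducedCStar G := indicatorOp (unitSet V)

variable [IsTopologicalGroupoid G] [T2Space G]

section

variable (h : IsAmple G) {V W : Set (UnitSpace G)} (hV : IsCompact V) (hVo : IsOpen V)
  (hW : IsCompact W) (hWo : IsOpen W)

include h hV hVo

lemma hasMatrix_unitProj : HasMatrix ((unitSet V).indicator 1) (unitProj V : RegularProduct G) :=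
  hasMatrix_indicatorOp (h.isCOB_unitSet hV hVo)

lemma star_unitProj : star (unitProj V : reducedCStar G) = unitProj V := by
  rw [unitProj, star_indicatorOp h (h.isCOB_unitSet hV hVo), setInv_unitSet]

lemma unitProj_mul_indicatorOp {B : Set G} (hB : IsCOB B) (hBV : ∀ g ∈ B, r g ∈ V) :
    unitProj V * indicatorOp B = indicatorOp B := by
  rw [unitProj, indicatorOp_mul h (h.isCOB_unitSet hV hVo) hB, setMul_unitSet_left]
  congr 1
  ext g
  exact ⟨fun hg => hg.1, fun hg => ⟨hg, hBV g hg⟩⟩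

/-- Since B⁻¹B = s(B), the indicator of B is a partial isometry carrying the projection of s(B)
under that of V. -/
lemma conj_unitProj {B : Set G} (hB : IsCOB B) (hBV : ∀ g ∈ B, r g ∈ V) :
    star (indicatorOp B) * unitProj V * indicatorOp B = unitProj (s '' B) := by
  rw [mul_assoc, unitProj_mul_indicatorOp h hV hVo hB hBV, star_indicatorOp h hB,
    indicatorOp_mul h (hB.setInv h) hB, setMul_setInv_self hB.2.injOn_r, unitProj]

lemma unitProj_entry_self {u : UnitSpace G} (γ : SourceFibre u) (hγ : r γ.1 ∈ V) :
    (unitProj V : RegularProduct G).entry γ γ = 1 := by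
  rw [hasMatrix_unitProj h hV hVo, mul_inv_eq, Set.indicator_of_mem (by simpa using hγ)]
  rfl

lemma unitProj_entry_eq_zero {u : UnitSpace G} (α γ : SourceFibre u)
    (hαγ : α = γ → r γ.1 ∉ V) : (unitProj V : RegularProduct G).entry α γ = 0 := by
  rw [hasMatrix_unitProj h hV hVo, Set.indicator_of_notMem]
  rintro ⟨v, hv, hvg⟩
  obtain ⟨h1, h2⟩ := (mul_inv_eq_unit_iff (α.2.trans γ.2.symm)).1 hvg.symm
  exact hαγ (Subtype.ext h1) (h2 ▸ hv)

open Classical in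
lemma hasMatrix_unitProj_mul {w : G → ℂ} {T : RegularProduct G} (hT : HasMatrix w T) :
    HasMatrix (fun g => if r g ∈ V then w g else 0) ((unitProj V : RegularProduct G) * T) := by
  refine (hasMatrix_unitProj h hV hVo).mul_of_left hT (h.isCOB_unitSet hV hVo).2.injOn_r
    (fun g hg => Set.mem_of_indicator_ne_zero hg) ?_ ?_
  · rintro _ b hub ⟨u, hu, rfl⟩
    rw [s_unit] at hub
    rw [unit_mul hub.symm, if_pos (hub ▸ hu), Set.indicator_of_mem (coe_mem_unitSet.2 hu),
      Pi.one_apply, one_mul]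
  · intro g hg
    rw [if_neg]
    exact fun hr => hg _ ⟨r g, hr, rfl⟩ (r_unit _)

open Classical in
lemma hasMatrix_mul_unitProj {w : G → ℂ} {T : RegularProduct G} (hT : HasMatrix w T) :
    HasMatrix (fun g => if s g ∈ V then w g else 0) (T * (unitProj V : RegularProduct G)) := by
  have h1 := (hasMatrix_unitProj_mul h hV hVo hT.star).star
  rw [star_mul, star_star, ← coe_star', star_unitProj h hV hVo] at h1
  convert h1 using 1
  ext g
  rw [r_inv, inv_inv']
  split_ifs <;> simp

include hW hWo in
lemma unitProj_mul_unitProj :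
    (unitProj V : reducedCStar G) * unitProj W = unitProj (V ∩ W) := by
  rw [unitProj, unitProj, indicatorOp_mul h (h.isCOB_unitSet hV hVo) (h.isCOB_unitSet hW hWo),
    setMul_unitSet_unitSet, unitProj]

lemma isStarProjection_unitProj : IsStarProjection (unitProj V : reducedCStar G) :=
  ⟨by rw [IsIdempotentElem, unitProj_mul_unitProj h hV hVo hV hVo, Set.inter_self],
    star_unitProj h hV hVo⟩

include hW hWo in
lemma unitProj_union (hd : Disjoint V W) :
    (unitProj (V ∪ W) : reducedCStar G) = unitProj V + unitProj W := by
  have e : unitSet (V ∪ W) = unitSet V ∪ unitSet W := Set.image_union ..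
  rw [unitProj, e, indicatorOp_union (h.isCOB_unitSet hV hVo) (h.isCOB_unitSet hW hWo)
    (e ▸ h.isCOB_unitSet (hV.union hW) (hVo.union hWo))
    ((Set.disjoint_image_iff Subtype.val_injective).2 hd)]
  rfl

/-- By minimality, every compact open set of units is a finite union of sets equivalent to subsets
of a given nonempty one. -/
lemma unitProj_mem_conjCone (hmin : IsMinimal G) (hne : V.Nonempty) {K : Set (UnitSpace G)}
    (hK : IsCompact K) (hKo : IsOpen K) :
    (unitProj K : reducedCStar G) ∈ conjCone (unitProj V : reducedCStar G) := by
  refine compactOpen_induction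
    (fun K => (unitProj K : reducedCStar G) ∈ conjCone (unitProj V : reducedCStar G))
    ?_ ?_ hK hKo ?_
  · have : (unitProj ∅ : reducedCStar G) = 0 := by
      rw [unitProj, unitSet, Set.image_empty, indicatorOp_empty]
    rw [this]
    exact zero_mem _
  · intro K L hK hKo hL hLo hd h1 h2
    rw [unitProj_union h hK hKo hL hLo hd]
    exact add_mem h1 h2
  · intro x _
    -- Minimality gives an arrow from x into V; a bisection around it carries a neighbourhood of x
    -- into V.
    obtain ⟨_, hv, a, rfl, rfl⟩ := (hmin x).inter_open_nonempty V hVo hne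
    obtain ⟨B, hB, haB, hBV⟩ := h.exists_isCOB (hVo.preimage continuous_r) hv
    refine ⟨s '' B, hB.1.image continuous_s, h.isOpenMap_s _ hB.2.isOpen, ⟨a, haB, rfl⟩, ?_⟩
    intro L hLB _ hL hLo
    have hC : IsCOB (B ∩ s ⁻¹' L) := hB.subset h
      (hB.1.inter_right (hL.isClosed.preimage continuous_s))
      (hB.2.isOpen.inter (hLo.preimage continuous_s)) Set.inter_subset_left
    have hs : s '' (B ∩ s ⁻¹' L) = L := by
      rw [Set.image_inter_preimage]; exact Set.inter_eq_right.2 hLB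
    rw [← hs, ← conj_unitProj h hV hVo hC fun g hg => hBV hg.1]
    exact AddSubmonoid.subset_closure ⟨_, rfl⟩

end

/-- These are local units for the span. Allowing every larger L lets two summands share one. -/
lemma exists_unitProj_mul_eq (h : IsAmple G) {T : RegularProduct G} (hT : T ∈ indicatorSpan G) :
    ∃ K : Set (UnitSpace G), IsCompact K ∧ IsOpen K ∧
      ∀ L, IsCompact L → IsOpen L → K ⊆ L → (unitProj L : RegularProduct G) * T = T := by
  induction hT using Submodule.span_induction with
  | mem T hT =>
    obtain ⟨B, hB, hT⟩ := hT
    rw [hT.unique (hasMatrix_indicatorOp hB)]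
    refine ⟨r '' B, hB.1.image continuous_r, h.isOpenMap_r _ hB.2.isOpen, ?_⟩
    intro L hL hLo hBL
    exact congrArg Subtype.val
      (unitProj_mul_indicatorOp h hL hLo hB fun g hg => hBL ⟨g, hg, rfl⟩)
  | zero => exact ⟨∅, isCompact_empty, isOpen_empty, fun L _ _ _ => mul_zero _⟩
  | add S T _ _ h1 h2 =>
    obtain ⟨K, hK, hKo, h1⟩ := h1
    obtain ⟨K', hK', hKo', h2⟩ := h2
    refine ⟨K ∪ K', hK.union hK', hKo.union hKo', fun L hL hLo hKL => ?_⟩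
    rw [mul_add, h1 L hL hLo (Set.subset_union_left.trans hKL),
      h2 L hL hLo (Set.subset_union_right.trans hKL)]
  | smul c T _ h1 =>
    obtain ⟨K, hK, hKo, h1⟩ := h1
    exact ⟨K, hK, hKo, fun L hL hLo hKL => by rw [mul_smul_comm, h1 L hL hLo hKL]⟩

/-- Minimality makes the projections of nonempty compact open sets of units full. -/
lemma mem_closure_conjCone_unitProj (h : IsAmple G) (hmin : IsMinimal G) {V : Set (UnitSpace G)}
    (hV : IsCompact V) (hVo : IsOpen V) (hne : V.Nonempty) {a : reducedCStar G} (ha : IsPos a) :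
    a ∈ closure (conjCone (unitProj V : reducedCStar G) : Set (reducedCStar G)) := by
  refine ha.mem_closure_conjCone (dense_indicatorSpan h) fun c hc => ?_
  obtain ⟨K, hK, hKo, hKc⟩ := exists_unitProj_mul_eq h hc
  have h1 : unitProj K * c = c := Subtype.ext (hKc K hK hKo subset_rfl)
  have h2 := conj_mem_conjCone (unitProj_mem_conjCone h hV hVo hmin hne hK hKo) c
  rwa [mul_assoc, h1] at h2

/-- Matrix functions of elements of the span: they are locally constant and, near units with
trivial isotropy, supported on units. -/
lemma exists_matrix_of_mem_indicatorSpan (h : IsAmple G) {T : RegularProduct G}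
    (hT : T ∈ indicatorSpan G) :
    ∃ w : G → ℂ, HasMatrix w T ∧ IsLocallyConstant w ∧
      ∀ u : UnitSpace G, {a : G | r a = u ∧ s a = u} = {(u : G)} →
        ∃ W ∈ 𝓝 u, ∀ g, w g ≠ 0 → s g ∈ W → r g ∈ W → g = (s g : G) := by
  classical
  induction hT using Submodule.span_induction with
  | mem T hT =>
    obtain ⟨B, hB, hT⟩ := hT
    refine ⟨_, hT, ?_, fun u hu => ?_⟩
    · have : B.indicator (1 : G → ℂ) = fun g => if g ∈ B then 1 else 0 := by
        ext g; simp [Set.indicator_apply]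
      rw [this, IsLocallyConstant.iff_eventually_eq]
      intro g
      by_cases hg : g ∈ B
      · filter_upwards [hB.2.isOpen.mem_nhds hg] with k hk
        rw [if_pos hk, if_pos hg]
      · filter_upwards [hB.isClopen.1.isOpen_compl.mem_nhds hg] with k hk
        rw [if_neg hk, if_neg hg]
    · obtain ⟨W, hW, hWB⟩ := hB.exists_nhds h hu
      exact ⟨W, hW, fun g hg => hWB g (Set.mem_of_indicator_ne_zero hg)⟩
  | zero => exact ⟨0, hasMatrix_zero, IsLocallyConstant.const 0, fun u _ =>
      ⟨Set.univ, Filter.univ_mem, fun g hg => absurd rfl hg⟩⟩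
  | add S T _ _ h1 h2 =>
    obtain ⟨w, hw, hl, hW⟩ := h1
    obtain ⟨w', hw', hl', hW'⟩ := h2
    refine ⟨w + w', hw.add hw', hl.add hl', fun u hu => ?_⟩
    obtain ⟨W, hW1, hW2⟩ := hW u hu
    obtain ⟨W', hW1', hW2'⟩ := hW' u hu
    refine ⟨W ∩ W', Filter.inter_mem hW1 hW1', fun g hg hs hr => ?_⟩
    by_cases h0 : w g = 0
    · refine hW2' g (fun h0' => hg ?_) hs.2 hr.2
      rw [Pi.add_apply, h0, h0', add_zero]
    · exact hW2 g h0 hs.1 hr.1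
  | smul c T _ h1 =>
    obtain ⟨w, hw, hl, hW⟩ := h1
    refine ⟨c • w, hw.smul c, ?_, fun u hu => ?_⟩
    · exact hl.comp (fun z => c * z)
    · obtain ⟨W, hW1, hW2⟩ := hW u hu
      exact ⟨W, hW1, fun g hg => hW2 g (right_ne_zero_of_mul hg)⟩

/-- Cutting down by a small compact open set near a unit with trivial isotropy turns an element of
the span into a multiple of a projection. -/
lemma exists_unitProj_cutdown (h : IsAmple G) (hprin : IsTopologicallyPrincipal G)
    {b : reducedCStar G} (hb : (b : RegularProduct G) ∈ indicatorSpan G) {u : UnitSpace G}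
    (γ : SourceFibre u) :
    ∃ V : Set (UnitSpace G), IsCompact V ∧ IsOpen V ∧ V.Nonempty ∧
      unitProj V * b * unitProj V = (b : RegularProduct G).entry γ γ • unitProj V := by
  classical
  obtain ⟨w, hw, hloc, hW⟩ := exists_matrix_of_mem_indicatorSpan h hb
  -- The value of w at r γ persists on an open set of units, which by density contains one with
  -- trivial isotropy.
  have hN : IsOpen {v : UnitSpace G | w v = w (r γ.1 : G)} :=
    (hloc.isOpen_fiber _).preimage continuous_subtype_val
  obtain ⟨v, hvN, hv⟩ := hprin.inter_open_nonempty _ hN ⟨r γ.1, rfl⟩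
  obtain ⟨W, hWv, hWg⟩ := hW v hv
  obtain ⟨V, hV, hVo, hvV, hVW⟩ := h.exists_compactOpen (Filter.inter_mem hWv (hN.mem_nhds hvN))
  refine ⟨V, hV, hVo, ⟨v, hvV⟩, Subtype.ext ?_⟩
  rw [coe_mul', coe_mul', coe_smul', hw, mul_inv_eq]
  refine (hasMatrix_mul_unitProj h hV hVo (hasMatrix_unitProj_mul h hV hVo hw)).unique ?_
  convert (hasMatrix_unitProj h hV hVo).smul (w (r γ.1 : G)) using 1
  ext g
  rw [Pi.smul_apply]
  by_cases hg : g ∈ unitSet V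
  · rw [Set.indicator_of_mem hg]
    obtain ⟨v', hv', rfl⟩ := hg
    rw [s_unit, r_unit, if_pos hv', if_pos hv']
    simpa using (hVW hv').2
  · rw [Set.indicator_of_notMem hg, smul_zero]
    split_ifs with h1 h2
    · by_contra h0
      have := hWg g h0 (hVW h1).1 (hVW h2).1
      exact hg ⟨s g, h1, this.symm⟩
    · rfl
    · rfl

/-- In a topologically principal groupoid, every nonzero positive element can be conjugated to the
projection of a nonempty compact open set of units. -/
lemma exists_conj_eq_unitProj (h : IsAmple G) (hprin : IsTopologicallyPrincipal G)
    {b : reducedCStar G} (hb : IsPos b) (hb0 : b ≠ 0) :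
    ∃ V : Set (UnitSpace G), IsCompact V ∧ IsOpen V ∧ V.Nonempty ∧
      ∃ x : reducedCStar G, star x * b * x = unitProj V := by
  have hbs := hb.isSelfAdjoint
  obtain ⟨d, hd⟩ := hb
  have hd0 : (d : RegularProduct G) ≠ 0 := by
    intro h0
    apply hb0
    have : d = 0 := Subtype.ext h0
    rw [hd, this, mul_zero]
  obtain ⟨u, α, γ, hαγ⟩ : ∃ (u : UnitSpace G) (α γ : SourceFibre u),
      (d : RegularProduct G).entry α γ ≠ 0 := by
    by_contra! hall
    exact hd0 (ext_entry fun u α γ => hall u α γ)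
  set c : ℝ := ‖(d : RegularProduct G).component u (pointMass γ)‖ ^ 2 with hc
  have hcb : (b : RegularProduct G).entry γ γ = (c : ℂ) := by
    rw [hd]; exact entry_star_mul_self _ γ
  have hc0 : 0 < c := by
    refine pow_pos (norm_pos_iff.2 fun h0 => hαγ ?_) 2
    rw [entry, h0]; rfl
  -- The error c/4 occurs twice, in the corner and in the scalar. The total c/2 becomes the required
  -- 1/2 after division by c.
  obtain ⟨b', hb', hbb'⟩ := Metric.mem_closure_iff.1 (dense_indicatorSpan h b) (c / 4) (by positivity)
  rw [dist_eq_norm] at hbb'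
  obtain ⟨V, hV, hVo, hne, hVb⟩ := exists_unitProj_cutdown h hprin hb' γ
  set z := (b' : RegularProduct G).entry γ γ with hz
  have hzc : ‖z - c‖ ≤ c / 4 := by
    rw [← hcb, hz, ← entry_sub]
    refine (norm_entry_le _ γ γ).trans ?_
    rw [norm_sub_rev]
    exact hbb'.le
  set p : reducedCStar G := unitProj V with hp
  have hproj : IsStarProjection p := isStarProjection_unitProj h hV hVo
  have hpp : p * p = p := hproj.isIdempotentElem.eq
  have hps : star p = p := hproj.isSelfAdjoint.star_eq
  have hp1 : ‖p‖ ≤ 1 := hproj.norm_le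
  have hcc : (c : ℂ) ≠ 0 := by exact_mod_cast hc0.ne'
  have hnorm : ‖p * b * p - (c : ℂ) • p‖ ≤ c / 2 := by
    have e : p * b * p - (c : ℂ) • p = p * (b - b') * p + (z - c) • p := by
      rw [mul_sub, sub_mul, hVb, sub_smul]; abel
    rw [e]
    have h1 : ‖p * (b - b') * p‖ ≤ c / 4 := by
      calc ‖p * (b - b') * p‖ ≤ ‖p‖ * ‖b - b'‖ * ‖p‖ :=
            (norm_mul_le _ _).trans (by gcongr; exact norm_mul_le _ _)
        _ ≤ 1 * ‖b - b'‖ * 1 := by gcongr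
        _ ≤ c / 4 := by rw [one_mul, mul_one]; exact hbb'.le
    have h2 : ‖(z - c) • p‖ ≤ c / 4 := by
      rw [norm_smul]
      calc ‖z - c‖ * ‖p‖ ≤ c / 4 * 1 := by gcongr
        _ = c / 4 := mul_one _
    calc _ ≤ _ := norm_add_le _ _
      _ ≤ c / 4 + c / 4 := add_le_add h1 h2
      _ = c / 2 := by ring
  obtain ⟨x, hx⟩ := exists_conj_eq_of_norm_sub_le (y := ((c⁻¹ : ℝ) : ℂ) • (p * b * p)) hproj (by
      rw [IsSelfAdjoint, star_smul, star_mul, star_mul, hbs.star_eq, hps, Complex.star_def,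
        Complex.conj_ofReal, mul_assoc])
    (by rw [mul_smul_comm, ← mul_assoc, ← mul_assoc, hpp])
    (by rw [smul_mul_assoc, mul_assoc, hpp]) (by
      have e : ((c⁻¹ : ℝ) : ℂ) • (p * b * p) - p =
          ((c⁻¹ : ℝ) : ℂ) • (p * b * p - (c : ℂ) • p) := by
        rw [smul_sub, smul_smul, Complex.ofReal_inv, inv_mul_cancel₀ hcc, one_smul]
      rw [e, norm_smul, Complex.norm_real, Real.norm_eq_abs, abs_of_pos (inv_pos.2 hc0)]
      calc c⁻¹ * _ ≤ c⁻¹ * (c / 2) := by gcongr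
        _ = 1 / 2 := by field_simp)
  -- The square root absorbs the scaling by c⁻¹, as the conjugating element appears twice.
  refine ⟨V, hV, hVo, hne, ((Real.sqrt c⁻¹ : ℝ) : ℂ) • (p * x), ?_⟩
  refine Eq.trans ?_ hx
  have hsq : ((Real.sqrt c⁻¹ : ℝ) : ℂ) * ((Real.sqrt c⁻¹ : ℝ) : ℂ) = ((c⁻¹ : ℝ) : ℂ) := by
    rw [← Complex.ofReal_mul, Real.mul_self_sqrt (inv_pos.2 hc0).le]
  rw [star_smul, star_mul, hps, Complex.star_def, Complex.conj_ofReal, smul_mul_assoc,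
    smul_mul_assoc, mul_smul_comm, smul_smul, hsq, mul_smul_comm, smul_mul_assoc]
  simp only [mul_assoc]

end ArrowGroupoid

/-! ### Projections of C₀(G⁽⁰⁾) as indicators of compact open sets. -/

namespace ArrowGroupoid

open RegularProduct CStarNotions

variable {G : Type*} [ArrowGroupoid G] [TopologicalSpace G] [IsTopologicalGroupoid G] [T2Space G]

open Classical in
lemma unitProj_component (h : IsAmple G) {V : Set (UnitSpace G)} (hV : IsCompact V)
    (hVo : IsOpen V) (u : UnitSpace G) (γ : SourceFibre u) :
    (unitProj V : RegularProduct G).component u (pointMass γ) =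
      (if r γ.1 ∈ V then (1 : ℂ) else 0) • pointMass γ := by
  refine lp.ext (funext fun α => ?_)
  show (unitProj V : RegularProduct G).entry α γ = _ * (pointMass γ : FibreSpace u) α
  rw [pointMass_apply]
  by_cases hαγ : α = γ
  · subst hαγ
    rw [if_pos rfl, mul_one]
    split_ifs with hm
    · exact unitProj_entry_self h hV hVo α hm
    · exact unitProj_entry_eq_zero h hV hVo α α fun _ => hm
  · rw [if_neg hαγ, mul_zero]
    exact unitProj_entry_eq_zero h hV hVo α γ fun he => absurd he hαγ

lemma isUnitSpaceImage_unitProj (h : IsAmple G) {V : Set (UnitSpace G)} (hV : IsCompact V)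
    (hVo : IsOpen V) {q : C₀(UnitSpace G, ℂ)} (hq : ∀ v, q v = V.indicator 1 v) :
    IsUnitSpaceImage q (unitProj V) := by
  classical
  intro u γ
  rw [unitProj_component h hV hVo, hq, Set.indicator_apply, Pi.one_apply]

lemma IsUnitSpaceImage.eq_unitProj (h : IsAmple G) {V : Set (UnitSpace G)} (hV : IsCompact V)
    (hVo : IsOpen V) {q : C₀(UnitSpace G, ℂ)} (hq : ∀ v, q v = V.indicator 1 v)
    {a : reducedCStar G} (ha : IsUnitSpaceImage q a) : a = unitProj V := by
  refine Subtype.ext (ext_entry fun u α γ => ?_)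
  rw [entry, entry, ha u γ, isUnitSpaceImage_unitProj h hV hVo hq u γ]

/-- A unit space projection is the indicator function of its support, a compact open set. -/
lemma apply_eq_indicator_of_isStarProjection {X : Type*} [TopologicalSpace X] {q : C₀(X, ℂ)}
    (hq : IsStarProjection q) (x : X) : q x = (tsupport q).indicator 1 x := by
  have h01 : ∀ x, q x = 0 ∨ q x = 1 := by
    intro x
    have h1 : q x * q x = q x := congrArg (fun f : C₀(X, ℂ) => f x) hq.isIdempotentElem.eq
    have h2 : q x * (q x - 1) = 0 := by rw [mul_sub, h1, mul_one, sub_self]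
    rcases mul_eq_zero.1 h2 with h | h
    · exact Or.inl h
    · exact Or.inr (sub_eq_zero.1 h)
  have hsup : Function.support q = q ⁻¹' {1} := by
    ext y
    rw [Function.mem_support, Set.mem_preimage, Set.mem_singleton_iff]
    rcases h01 y with h | h <;> simp [h]
  have hcl : tsupport q = Function.support q := by
    refine IsClosed.closure_eq ?_
    rw [hsup]
    exact isClosed_singleton.preimage (map_continuous q)
  rw [hcl]
  classical
  rw [Set.indicator_apply, Function.mem_support]
  rcases h01 x with h | h <;> simp [h]

/-- The indicator function of a compact open set, as a projection. -/
lemma exists_isStarProjection_indicator {X : Type*} [TopologicalSpace X] [T2Space X] {V : Set X}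
    (hV : IsCompact V) (hVo : IsOpen V) (hne : V.Nonempty) :
    ∃ q : C₀(X, ℂ), IsStarProjection q ∧ q ≠ 0 ∧ tsupport q = V ∧
      ∀ v, q v = V.indicator 1 v := by
  classical
  have hcl : IsClopen V := ⟨hV.isClosed, hVo⟩
  have hcont : Continuous (V.indicator (1 : X → ℂ)) :=
    (continuous_const (y := (1 : ℂ))).indicator (by simp [hcl.frontier_eq])
  have hcs : HasCompactSupport (V.indicator (1 : X → ℂ)) :=
    HasCompactSupport.intro hV fun g hg => Set.indicator_of_notMem hg _
  refine ⟨⟨⟨V.indicator 1, hcont⟩, hcs.is_zero_at_infty⟩, ⟨?_, ?_⟩, ?_, ?_, fun v => rfl⟩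
  · refine ZeroAtInftyContinuousMap.ext fun x => ?_
    show V.indicator (1 : X → ℂ) x * V.indicator (1 : X → ℂ) x = V.indicator (1 : X → ℂ) x
    rw [Set.indicator_apply]
    split_ifs <;> simp
  · refine ZeroAtInftyContinuousMap.ext fun x => ?_
    show star (V.indicator (1 : X → ℂ) x) = V.indicator (1 : X → ℂ) x
    rw [Set.indicator_apply]
    split_ifs <;> simp
  · obtain ⟨v, hv⟩ := hne
    intro h0
    have : V.indicator (1 : X → ℂ) v = 0 := congrArg (fun f : C₀(X, ℂ) => f v) h0
    rw [Set.indicator_of_mem hv] at this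
    exact one_ne_zero this
  · show closure (Function.support (V.indicator (1 : X → ℂ))) = V
    rw [Set.support_indicator]
    simp [hV.isClosed.closure_eq]

/-! ### From infinite projections near one unit to pure infiniteness. -/

section Sufficiency

variable (h : IsAmple G) (hprin : IsTopologicallyPrincipal G) (hmin : IsMinimal G)

include h hprin hmin

/-- The defect of an infinite projection is full. -/
lemma mem_closure_conjCone_defect {p v : reducedCStar G} (hp : IsStarProjection p)
    (h1 : star v * v = p) (h2 : p * (v * star v) = v * star v) (h3 : v * star v ≠ p)
    {a : reducedCStar G} (ha : IsPos a) :
    a ∈ closure (conjCone (p - v * star v) : Set (reducedCStar G)) := by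
  have he := isStarProjection_defect hp h1 h2
  obtain ⟨W, hW, hWo, hne, y, hy⟩ := exists_conj_eq_unitProj h hprin
    (IsStarProjection.isPos he) (sub_ne_zero.2 h3.symm)
  refine closure_mono ?_ (mem_closure_conjCone_unitProj h hmin hW hWo hne ha)
  exact conjCone_le (hy ▸ AddSubmonoid.subset_closure ⟨y, rfl⟩)

lemma cuntzBelow_of_isInfiniteProjection {p : reducedCStar G} (hp : IsInfiniteProjection p)
    {a : reducedCStar G} (ha : IsPos a) : CuntzBelow a p := by
  obtain ⟨hp, v, h1, h2, h3⟩ := hp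
  exact cuntzBelow_of_mem_closure_conjCone_defect hp h1 h2
    (mem_closure_conjCone_defect h hprin hmin hp h1 h2 h3 ha)

/-- A character kills the defect, hence all positive elements, hence the local units, and therefore
a dense subspace. -/
lemma isEmpty_characterSpace_of_isInfiniteProjection {p : reducedCStar G}
    (hp : IsInfiniteProjection p) : IsEmpty (WeakDual.characterSpace ℂ (reducedCStar G)) := by
  obtain ⟨hp, v, h1, h2, h3⟩ := hp
  refine ⟨fun φ => ?_⟩
  have hpos : ∀ a : reducedCStar G, IsPos a → φ a = 0 := fun a ha =>
    character_eq_zero_of_mem_closure_conjCone_defect h1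
      (mem_closure_conjCone_defect h hprin hmin hp h1 h2 h3 ha) φ
  have hall : ∀ a : reducedCStar G, φ a = 0 := by
    have hcl : IsClosed {a : reducedCStar G | φ a = 0} :=
      isClosed_eq (map_continuous φ) continuous_const
    intro a
    refine hcl.closure_subset_iff.2 ?_ (dense_indicatorSpan h a)
    intro c hc
    obtain ⟨K, hK, hKo, hKc⟩ := exists_unitProj_mul_eq h hc
    have e : unitProj K * c = c := Subtype.ext (hKc K hK hKo subset_rfl)
    show φ c = 0
    rw [← e, map_mul,
      hpos _ (IsStarProjection.isPos (isStarProjection_unitProj h hK hKo)), zero_mul]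
  exact φ.2.1 (ContinuousLinearMap.ext hall)

theorem isPurelyInfinite_of_infinite_basis {x : UnitSpace G} {D : Set (Set (UnitSpace G))}
    (hbasis : (𝓝 x).HasBasis (fun U => U ∈ D) id) (hD : ∀ U ∈ D, IsCompact U ∧ IsOpen U)
    (hinf : ∀ U ∈ D, U.Nonempty → IsInfiniteProjection (unitProj U : reducedCStar G)) :
    IsPurelyInfinite (reducedCStar G) := by
  have hxU : ∀ U ∈ D, x ∈ U := fun U hU => mem_of_mem_nhds (hbasis.mem_of_mem hU)
  have key : ∀ a b : reducedCStar G, IsPos a → IsPos b → b ≠ 0 → CuntzBelow a b := by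
    intro a b ha hb hb0
    obtain ⟨V, hV, hVo, hne, z, hz⟩ := exists_conj_eq_unitProj h hprin hb hb0
    -- An arrow from x into V extends to a bisection, whose source is then shrunk to a member U of
    -- D. This gives the chain a ≾ 1_U, with 1_U a conjugate of 1_V and 1_V a conjugate of b.
    obtain ⟨_, hv, g, rfl, rfl⟩ := (hmin x).inter_open_nonempty V hVo hne
    obtain ⟨B, hB, hgB, hBV⟩ := h.exists_isCOB (hVo.preimage continuous_r) hv
    obtain ⟨U, hU, hUB⟩ := hbasis.mem_iff.1
      ((h.isOpenMap_s _ hB.2.isOpen).mem_nhds ⟨g, hgB, rfl⟩)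
    have hC : IsCOB (B ∩ s ⁻¹' U) := hB.subset h
      (hB.1.inter_right ((hD U hU).1.isClosed.preimage continuous_s))
      (hB.2.isOpen.inter ((hD U hU).2.preimage continuous_s)) Set.inter_subset_left
    have hs : s '' (B ∩ s ⁻¹' U) = U := by
      rw [Set.image_inter_preimage]; exact Set.inter_eq_right.2 hUB
    have hUV := conj_unitProj h hV hVo hC fun g hg => hBV hg.1
    rw [hs] at hUV
    exact ((cuntzBelow_of_isInfiniteProjection h hprin hmin
      (hinf U hU ⟨_, hxU U hU⟩) ha).conj hUV).conj hz
  refine ⟨?_, fun a b ha hb => ⟨fun hab => hab.mem_idealClosure, fun hab => ?_⟩⟩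
  · obtain ⟨U, hU⟩ := hbasis.ex_mem
    exact isEmpty_characterSpace_of_isInfiniteProjection h hprin hmin
      (hinf U hU ⟨_, hxU U hU⟩)
  · by_cases hb0 : b = 0
    · subst hb0
      rw [eq_zero_of_mem_idealClosure_zero hab]
      exact ⟨fun _ => 0, by simp⟩
    · exact key a b ha hb hb0

end Sufficiency

/-! ### From pure infiniteness to infinite projections. -/

section Necessity

variable (h : IsAmple G)

include h

/-- Minimality puts 1_K in the ideal generated by 1_V, and pure infiniteness turns that into
comparison. -/
lemma cuntzBelow_unitProj (hmin : IsMinimal G) (hpi : IsPurelyInfinite (reducedCStar G))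
    {V : Set (UnitSpace G)} (hV : IsCompact V) (hVo : IsOpen V) (hne : V.Nonempty)
    {K : Set (UnitSpace G)} (hK : IsCompact K) (hKo : IsOpen K) :
    CuntzBelow (unitProj K : reducedCStar G) (unitProj V) :=
  (hpi.2 _ _ (IsStarProjection.isPos (isStarProjection_unitProj h hK hKo))
    (IsStarProjection.isPos (isStarProjection_unitProj h hV hVo))).2
    (conjCone_subset_idealClosure _ (unitProj_mem_conjCone h hV hVo hmin hne hK hKo))

/-- At an isolated unit with trivial isotropy, `x⋆ 1_{u} x` has rank one on `ℓ²(G u)`. -/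
lemma entry_conj_unitProj_singleton {u : UnitSpace G} (hu : IsOpen ({u} : Set (UnitSpace G)))
    (hiso : {a : G | r a = u ∧ s a = u} = {(u : G)}) (x : RegularProduct G)
    (α γ : SourceFibre u) :
    (star x * (unitProj {u} : RegularProduct G) * x).entry α γ =
      star (x.entry ⟨u, s_unit u⟩ α) * x.entry ⟨u, s_unit u⟩ γ := by
  classical
  set o : SourceFibre u := ⟨u, s_unit u⟩ with ho
  have hP : ∀ β β' : SourceFibre u, β ≠ o ∨ β' ≠ o →
      (unitProj {u} : RegularProduct G).entry β β' = 0 := by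
    intro β β' hne
    refine unitProj_entry_eq_zero h isCompact_singleton hu β β' ?_
    rintro rfl hr
    have hβ : β.1 ∈ {a : G | r a = u ∧ s a = u} := ⟨hr, β.2⟩
    rw [hiso] at hβ
    have : β = o := Subtype.ext hβ
    exact hne.elim (fun h => h this) (fun h => h this)
  have hP1 : (unitProj {u} : RegularProduct G).entry o o = 1 :=
    unitProj_entry_self h isCompact_singleton hu o (by simp [ho])
  have h1 : ∀ β : SourceFibre u, (star x * (unitProj {u} : RegularProduct G)).entry α β =
      if β = o then star (x.entry o α) else 0 := by
    intro β
    refine (hasSum_entry_mul _ _ α β).unique ?_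
    have := hasSum_single (f := fun β' => (star x).entry α β' *
      (unitProj {u} : RegularProduct G).entry β' β) o fun β' hne => by
        rw [hP β' β (Or.inl hne), mul_zero]
    convert this using 1
    split_ifs with hβ
    · rw [hβ, hP1, mul_one, entry_star]
    · rw [hP o β (Or.inr hβ), mul_zero]
  refine (hasSum_entry_mul _ _ α γ).unique ?_
  have := hasSum_single (f := fun β => (star x * (unitProj {u} : RegularProduct G)).entry α β *
    x.entry β γ) o fun β hne => by rw [h1, if_neg hne, zero_mul]
  convert this using 1
  rw [h1, if_pos rfl]

/-- If there is only one morphism, the reduced C⋆-algebra has a character. -/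
lemma nonempty_characterSpace_of_unique (u : UnitSpace G) (hu : ∀ g : G, g = u) :
    Nonempty (WeakDual.characterSpace ℂ (reducedCStar G)) := by
  set o : SourceFibre u := ⟨u, s_unit u⟩ with ho
  have huniq : ∀ α : SourceFibre u, α = o := fun α => Subtype.ext (hu α.1)
  let L : reducedCStar G →ₗ[ℂ] ℂ :=
    { toFun := fun a => (a : RegularProduct G).entry o o
      map_add' := fun a b => rfl
      map_smul' := fun c a => rfl }
  let φ : reducedCStar G →L[ℂ] ℂ := L.mkContinuous 1 fun a => by
    rw [one_mul]; exact norm_entry_le (a : RegularProduct G) o o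
  have hone : (Set.univ : Set (UnitSpace G)) = {u} := by
    ext v; simp [Subtype.ext (hu v)]
  have hop : IsOpen ({u} : Set (UnitSpace G)) := hone ▸ isOpen_univ
  refine ⟨⟨φ, ?_, ?_⟩⟩
  · intro h0
    have h1 : φ (unitProj {u}) = 0 := by
      exact congrArg (fun ψ : reducedCStar G →L[ℂ] ℂ => ψ (unitProj {u})) h0
    have h2 : φ (unitProj {u}) = 1 :=
      unitProj_entry_self h isCompact_singleton hop o (by simp [ho])
    rw [h1] at h2
    exact zero_ne_one h2
  · intro a b
    show (a * b : RegularProduct G).entry o o = _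
    refine (hasSum_entry_mul (a : RegularProduct G) b o o).unique ?_
    exact hasSum_single (f := fun β => (a : RegularProduct G).entry o β *
      (b : RegularProduct G).entry β o) o fun β hne => absurd (huniq β) hne

/-- If the reduced C⋆-algebra is purely infinite, there are no isolated units. -/
lemma not_isOpen_singleton_of_isPurelyInfinite (hprin : IsTopologicallyPrincipal G)
    (hmin : IsMinimal G) (hpi : IsPurelyInfinite (reducedCStar G)) (u : UnitSpace G) :
    ¬ IsOpen ({u} : Set (UnitSpace G)) := by
  intro hu
  have hiso : {a : G | r a = u ∧ s a = u} = {(u : G)} := by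
    obtain ⟨v, hv, hv'⟩ := hprin.inter_open_nonempty _ hu ⟨u, rfl⟩
    rw [Set.mem_singleton_iff] at hv
    rwa [hv] at hv'
  -- A second unit v lies in the orbit of u by minimality. The projection of a compact open set
  -- containing both has rank at least two on ℓ²(G u), yet would be a conjugate of the rank-one
  -- 1_{u}.
  by_cases hex : ∃ v : UnitSpace G, v ≠ u
  · obtain ⟨v, hvu⟩ := hex
    obtain ⟨_, hau, a, hav, rfl⟩ := (hmin v).inter_open_nonempty _ hu ⟨u, rfl⟩
    rw [Set.mem_singleton_iff] at hau
    obtain ⟨K₁, hK₁, hK₁o, huK, -⟩ := h.exists_compactOpen (u := u) Filter.univ_mem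
    obtain ⟨K₂, hK₂, hK₂o, hvK, -⟩ := h.exists_compactOpen (u := v) Filter.univ_mem
    have hK := hK₁.union hK₂
    have hKo := hK₁o.union hK₂o
    obtain ⟨x, hx⟩ := (cuntzBelow_unitProj h hmin hpi isCompact_singleton hu ⟨u, rfl⟩ hK
      hKo).exists_eq (isStarProjection_unitProj h hK hKo)
      (star_unitProj h isCompact_singleton hu)
    have hx' := congrArg Subtype.val hx
    have hent : ∀ α γ : SourceFibre u, (unitProj (K₁ ∪ K₂) : RegularProduct G).entry α γ =
        star ((x : RegularProduct G).entry ⟨u, s_unit u⟩ α) *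
          (x : RegularProduct G).entry ⟨u, s_unit u⟩ γ := by
      intro α γ
      rw [← entry_conj_unitProj_singleton h hu hiso]
      exact congrArg (fun T : RegularProduct G => T.entry α γ) hx'.symm
    set o : SourceFibre u := ⟨u, s_unit u⟩ with ho
    set γ : SourceFibre u := ⟨a⁻¹, by rw [s_inv, hau]⟩ with hγ
    have hγr : r γ.1 = v := by rw [← hav]; exact r_inv a
    have hne : o ≠ γ := by
      intro he
      apply hvu
      rw [← hγr, ← he]
      exact r_unit u
    have e1 := hent o o
    have e2 := hent γ γ
    have e3 := hent o γ
    rw [unitProj_entry_self h hK hKo o (by simp [ho, huK])] at e1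
    rw [unitProj_entry_self h hK hKo γ (by rw [hγr]; exact Or.inr hvK)] at e2
    rw [unitProj_entry_eq_zero h hK hKo o γ fun he => absurd he hne] at e3
    -- The two diagonal entries 1 make both factors nonzero, while the off-diagonal entry 0 kills
    -- one of them.
    rcases mul_eq_zero.1 e3.symm with h0 | h0
    · rw [h0, zero_mul] at e1; exact one_ne_zero e1
    · rw [h0, mul_zero] at e2; exact one_ne_zero e2
  · push Not at hex
    refine (not_isEmpty_iff.2 (nonempty_characterSpace_of_unique h u fun g => ?_)) hpi.1
    have : g ∈ {a : G | r a = u ∧ s a = u} := ⟨hex _, hex _⟩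
    rwa [hiso] at this

/-- As no unit is isolated, U has a second point y, and a nonempty compact open V ⊆ U omits it. Then
1_U is exactly a conjugate of its subprojection 1_V, and the diagonal entry at y tells the two
apart. -/
theorem isInfiniteProjection_unitProj (hprin : IsTopologicallyPrincipal G)
    (hmin : IsMinimal G) (hpi : IsPurelyInfinite (reducedCStar G)) {U : Set (UnitSpace G)}
    (hU : IsCompact U) (hUo : IsOpen U) (hne : U.Nonempty) :
    IsInfiniteProjection (unitProj U : reducedCStar G) := by
  obtain ⟨x, hx⟩ := hne
  obtain ⟨y, hy, hyx⟩ : ∃ y ∈ U, y ≠ x := by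
    by_contra! hall
    refine not_isOpen_singleton_of_isPurelyInfinite h hprin hmin hpi x ?_
    rwa [← Set.eq_singleton_iff_unique_mem.2 ⟨hx, hall⟩]
  obtain ⟨V, hV, hVo, hxV, hVU⟩ := h.exists_compactOpen (u := x) (U := U \ {y})
    ((hUo.sdiff isClosed_singleton).mem_nhds ⟨hx, fun he => hyx he.symm⟩)
  obtain ⟨z, hz⟩ := (cuntzBelow_unitProj h hmin hpi hV hVo ⟨x, hxV⟩ hU hUo).exists_eq
    (isStarProjection_unitProj h hU hUo) (star_unitProj h hV hVo)
  refine isInfiniteProjection_of_conj (isStarProjection_unitProj h hU hUo)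
    (isStarProjection_unitProj h hV hVo) ?_ ?_ hz
  · rw [unitProj_mul_unitProj h hU hUo hV hVo,
      Set.inter_eq_right.2 (hVU.trans Set.sdiff_subset)]
  · intro he
    set o : SourceFibre y := ⟨y, s_unit y⟩ with ho
    have h1 := unitProj_entry_self h hU hUo o (by simpa [ho] using hy)
    rw [← he, unitProj_entry_eq_zero h hV hVo o o fun _ hm => ?_] at h1
    · exact zero_ne_one h1
    · rw [ho, r_unit] at hm
      exact (hVU hm).2 rfl

end Necessity

end ArrowGroupoid

end

/-! ### The equivalence. -/

theorem corollary4p2 (G : Type*) [TopologicalSpace G] [ArrowGroupoid G] [IsTopologicalGroupoid G]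
    [Nonempty G] [SecondCountableTopology G] [T2Space G]
    (hample : ArrowGroupoid.IsAmple G)
    (hprincipal : ArrowGroupoid.IsTopologicallyPrincipal G)
    (hminimal : ArrowGroupoid.IsMinimal G) :
    CStarNotions.IsPurelyInfinite (ArrowGroupoid.reducedCStar G) ↔
      ∃ (x : ArrowGroupoid.UnitSpace G) (D : Set (Set (ArrowGroupoid.UnitSpace G))),
        (𝓝 x).HasBasis (fun U => U ∈ D) id ∧
        (∀ U ∈ D, IsCompact U ∧ IsOpen U) ∧
        ∀ q : C₀(ArrowGroupoid.UnitSpace G, ℂ), IsStarProjection q → q ≠ 0 → tsupport q ∈ D →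
          ∃ p : ArrowGroupoid.reducedCStar G,
            ArrowGroupoid.IsUnitSpaceImage q p ∧ CStarNotions.IsInfiniteProjection p := by
  constructor
  · intro hpi
    obtain ⟨g⟩ := ‹Nonempty G›
    -- Any unit works, with all of its compact open neighbourhoods.
    refine ⟨ArrowGroupoid.s g, {U | IsCompact U ∧ IsOpen U ∧ ArrowGroupoid.s g ∈ U}, ?_,
      fun U hU => ⟨hU.1, hU.2.1⟩, ?_⟩
    · refine Filter.hasBasis_iff.2 fun t => ⟨fun ht => ?_, ?_⟩
      · obtain ⟨V, hV, hVo, hxV, hVt⟩ := hample.exists_compactOpen ht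
        exact ⟨V, ⟨hV, hVo, hxV⟩, hVt⟩
      · rintro ⟨V, ⟨-, hVo, hxV⟩, hVt⟩
        exact Filter.mem_of_superset (hVo.mem_nhds hxV) hVt
    · intro q hq _ hqD
      exact ⟨ArrowGroupoid.unitProj (tsupport q),
        ArrowGroupoid.isUnitSpaceImage_unitProj hample hqD.1 hqD.2.1
          (ArrowGroupoid.apply_eq_indicator_of_isStarProjection hq),
        ArrowGroupoid.isInfiniteProjection_unitProj hample hprincipal hminimal hpi hqD.1 hqD.2.1
          ⟨_, hqD.2.2⟩⟩
  · rintro ⟨x, D, hbasis, hD, hinf⟩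
    refine ArrowGroupoid.isPurelyInfinite_of_infinite_basis hample hprincipal hminimal hbasis hD
      fun U hU hne => ?_
    obtain ⟨q, hq, hq0, hqU, hqv⟩ :=
      ArrowGroupoid.exists_isStarProjection_indicator (hD U hU).1 (hD U hU).2 hne
    obtain ⟨p, hp, hpinf⟩ := hinf q hq hq0 (hqU ▸ hU)
    rwa [hp.eq_unitProj hample (hD U hU).1 (hD U hU).2 hqv] at hpinf
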